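/- **Models.** For $q\in[0,1]$ let $G(n,q)$ be the Erdős–Rényi graph on $[n]$. Let $G(n,k,p)$ be a sample of $G(n,p)$ to which a clique on a uniformly random $k$-subset of $[n]$ is added. Let $G(n,k,p,q)$ be obtained by choosing a uniformly random subset $S\subseteq[n]$ with exactly $k$ elements and then, independently, joining every two nodes of $S$ with probability $p$ and every other two nodes with probability $q$. The detection problem $\mathrm{PC}_D(n,k,p)$ is $H_0:G\sim G(n,p)$ against $H_1:G\sim G(n,k,p)$, and $\mathrm{PDS}_D(n,k,p,q)$ is $H_0:G\sim G(n,q)$ against $H_1:G\sim G(n,k,p,q)$. The Type I$+$II error of a randomized test $A$ with values in $\{0,1\}$ is $\mathbb P_{H_0}[A(G)=1]+\mathbb P_{H_1}[A(G)=0]$. **Computation.** A sequence of randomized tests $\phi_n$ on graphs with $N_n$ vertices consists of one randomized algorithm for each $n$, given as a straight-line program over one-bit registers (equivalently, a Boolean circuit) that reads edge indicators of the input and independent uniform random bits and computes constants and NANDs, one instruction per time step. The sequence runs in randomized polynomial time if the number of random bits plus the number of steps of $\phi_n$ is at most $P(N_n)$ for one polynomial $P$ and all $n$. **PC conjecture at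 density $p$.** For every randomized polynomial-time sequence of tests $A_n$ on graphs with $n$ vertices and every sequence of positive integers $k_n$ with $\limsup_{n\to\infty}\log_n k_n<\tfrac12$, the Type I$+$II errors of $A_n$ on $\mathrm{PC}_D(n,k_n,p)$ have $\liminf_{n\to\infty}$ at least $1$. **Regime.** For $c>1$, $\alpha\in[0,2)$ and $\beta\in(0,1)$, say that $(N_n,K_n,p_n,q_n)_{n\in\mathbb N}$, with integers $1\le K_n\le N_n$ and $p_n\in[0,1]$, $q_n\in(0,1]$, is in the regime $(c,\alpha,\beta)$ if $N_n\to\infty$ and $$\lim_{n\to\infty}\frac{\log q_n^{-1}}{\log N_n}=\alpha,\qquad \lim_{n\to\infty}\frac{\log K_n}{\log N_n}=\beta,\qquad \lim_{n\to\infty}\frac{p_n}{q_n}=c .$$ **Theorem.** Fix $c>1$ and $\alpha\in[0,2)$. The computational boundary for $\mathrm{PDS}_D$ in this regime is $\beta^*=\tfrac12+\tfrac\alpha4$, in the following sense. 1. For every $\beta\in(0,1)$ with $\beta<\tfrac12+\tfrac\alpha4$ there is a sequence $(N_n,K_n,p_n,q_n)$ in the regime $(c,\alpha,\beta)$ such that,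 if the PC conjecture holds at each fixed density in $(0,\tfrac12]$, then for every randomized polynomial-time sequence of tests $\phi_n$ on graphs with $N_n$ vertices, the Type I$+$II errors of $\phi_n$ on $\mathrm{PDS}_D(N_n,K_n,p_n,q_n)$ have $\liminf_{n\to\infty}$ at least $1$. 2. For every $\beta\in(0,1)$ with $\beta>\tfrac12+\tfrac\alpha4$ and every sequence $(N_n,K_n,p_n,q_n)$ in the regime $(c,\alpha,\beta)$ there is a randomized polynomial-time sequence of tests $\phi_n$ on graphs with $N_n$ vertices whose Type I$+$II error on $\mathrm{PDS}_D(N_n,K_n,p_n,q_n)$ tends to $0$. -/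

import Mathlib

open MeasureTheory Filter Topology

noncomputable section

/-! ### Planted random graph models -/

/-- The clique on the vertex set `S`, with no edges elsewhere. -/
def cliqueOn {n : ℕ} (S : Finset (Fin n)) : SimpleGraph (Fin n) where
  Adj i j := i ≠ j ∧ i ∈ S ∧ j ∈ S
  symm := ⟨fun _ _ h => ⟨h.1.symm, h.2.2, h.2.1⟩⟩
  loopless := ⟨fun _ h => h.1 rfl⟩

/-- The graph that agrees with `A` on the pairs inside `S` and with `B` on all other pairs. -/
def glueGraph {n : ℕ} (S : Finset (Fin n)) (A B : SimpleGraph (Fin n)) :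
    SimpleGraph (Fin n) where
  Adj i j := ((i ∈ S ∧ j ∈ S) ∧ A.Adj i j) ∨ (¬ (i ∈ S ∧ j ∈ S) ∧ B.Adj i j)
  symm := ⟨by
    rintro i j (⟨⟨hi, hj⟩, h⟩ | ⟨hn, h⟩)
    · exact Or.inl ⟨⟨hj, hi⟩, h.symm⟩
    · exact Or.inr ⟨fun hc => hn ⟨hc.2, hc.1⟩, h.symm⟩⟩
  loopless := ⟨by
    rintro i (⟨_, h⟩ | ⟨_, h⟩)
    · exact A.irrefl h
    · exact B.irrefl h⟩

/-- The mixture of the laws `μ S`, with `S` uniform among the `k`-subsets of the vertex set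
(meaningful for `k ≤ n`; the zero measure for `k > n`). -/
def uniformMixture (n k : ℕ) (μ : Finset (Fin n) → Measure (SimpleGraph (Fin n))) :
    Measure (SimpleGraph (Fin n)) :=
  ((n.choose k : ENNReal))⁻¹ • ∑ S ∈ Finset.powersetCard k Finset.univ, μ S

/-- `G(n, k, p)`: a sample of `G(n, p)` to which a clique on a uniformly random `k`-subset of the
vertices is added. -/
def plantedClique (n k : ℕ) (p : unitInterval) : Measure (SimpleGraph (Fin n)) :=
  uniformMixture n k fun S =>
    (SimpleGraph.binomialRandom (Fin n) p).map (fun G => G ⊔ cliqueOn S)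

/-- `G(n, k, p, q)`: choose a uniformly random `k`-subset `S` of the vertices; independently, join
every two nodes of `S` with probability `p` and every other two nodes with probability `q`. -/
def plantedDense (n k : ℕ) (p q : unitInterval) : Measure (SimpleGraph (Fin n)) :=
  uniformMixture n k fun S =>
    ((SimpleGraph.binomialRandom (Fin n) p).prod (SimpleGraph.binomialRandom (Fin n) q)).map
      (fun AB => glueGraph S AB.1 AB.2)

/-! ### Randomized polynomial-time tests

A sequence of randomized tests `A₀, A₁, A₂, …` consists of one algorithm for each index. For a
fixed input length an algorithm is given as a straight-line program (equivalently a Boolean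
circuit) over one-bit registers, which reads edge indicators of the input graph and independent
uniform random bits. Every instruction is one time step. -/

/-- Instructions of a program with input a graph on `n` vertices and `r` random bits. The first
argument `d` is always the register that is overwritten. -/
inductive Instr (n r : ℕ) : Type
  /-- write the constant `b` -/
  | const (d : ℕ) (b : Bool) : Instr n r
  /-- read whether the vertices `i` and `j` are adjacent -/
  | edge (d : ℕ) (i j : Fin n) : Instr n r
  /-- read the `s`-th random bit -/
  | coin (d : ℕ) (s : Fin r) : Instr n r
  /-- write the NAND of the registers `a` and `b` -/
  | nand (d a b : ℕ) : Instr n r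

open Classical in
/-- The effect of one instruction on the registers, for input graph `G` and random bits `ω`. -/
def Instr.exec {n r : ℕ} (G : SimpleGraph (Fin n)) (ω : Fin r → Bool) (x : ℕ → Bool) :
    Instr n r → (ℕ → Bool)
  | .const d b => Function.update x d b
  | .edge d i j => Function.update x d (decide (G.Adj i j))
  | .coin d s => Function.update x d (ω s)
  | .nand d a b => Function.update x d (!(x a && x b))

/-- A randomized test on graphs with `n` vertices: a number of random bits and a program. -/
structure RandomizedTest (n : ℕ) where
  /-- number of independent uniform random bits -/
  coins : ℕ
  /-- the instructions, executed in order -/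
  prog : List (Instr n coins)

namespace RandomizedTest

variable {n : ℕ}

/-- The output bit: all registers are initially `false`, and the output is the final content of
register `0`. The output `true` stands for the decision `H₁`. -/
def run (A : RandomizedTest n) (G : SimpleGraph (Fin n)) (ω : Fin A.coins → Bool) : Bool :=
  (A.prog.foldl (Instr.exec G ω) (fun _ => false)) 0

/-- The resources used: number of random bits plus number of executed steps. -/
def cost (A : RandomizedTest n) : ℕ := A.coins + A.prog.length

/-- The probability, over the random bits, that the test outputs `1` on the graph `G`. -/
def acceptProb (A : RandomizedTest n) (G : SimpleGraph (Fin n)) : ℝ :=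
  ((Finset.univ.filter fun ω : Fin A.coins → Bool => A.run G ω = true).card : ℝ) / 2 ^ A.coins

/-- The Type I + II error `P_{H₀}[A = 1] + P_{H₁}[A = 0]`, for `H₀ : G ∼ μ₀` and `H₁ : G ∼ μ₁`. -/
def error (A : RandomizedTest n) (μ₀ μ₁ : Measure (SimpleGraph (Fin n))) : ℝ :=
  (∫ G, A.acceptProb G ∂μ₀) + ∫ G, (1 - A.acceptProb G) ∂μ₁

end RandomizedTest

/-- A sequence of tests on graphs with `N 0, N 1, N 2, …` vertices runs in randomized polynomial
time: random bits and steps are bounded by one polynomial in the number of vertices. -/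
def IsPolyTime {N : ℕ → ℕ} (A : ∀ n, RandomizedTest (N n)) : Prop :=
  ∃ P : Polynomial ℕ, ∀ n, (A n).cost ≤ P.eval (N n)

/-! ### Detection problems -/

/-- Type I + II error of a test on `PC_D(n, k, p)`. -/
def errorPC (n k : ℕ) (p : unitInterval) (A : RandomizedTest n) : ℝ :=
  A.error (SimpleGraph.binomialRandom (Fin n) p) (plantedClique n k p)

/-- Type I + II error of a test on `PDS_D(n, k, p, q)`. -/
def errorPDS (n k : ℕ) (p q : unitInterval) (A : RandomizedTest n) : ℝ :=
  A.error (SimpleGraph.binomialRandom (Fin n) q) (plantedDense n k p q)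

/-- The planted clique conjecture at the fixed edge density `p`. -/
def PCConjecture (p : unitInterval) : Prop :=
  ∀ A : ∀ n, RandomizedTest n, IsPolyTime A →
    ∀ k : ℕ → ℕ, (∀ n, 0 < k n) →
      limsup (fun n : ℕ => ((Real.logb n (k n) : ℝ) : EReal)) atTop < ((1 / 2 : ℝ) : EReal) →
        1 ≤ liminf (fun n => errorPC n (k n) p (A n)) atTop

/-- The parameter regime `q = Θ̃(N^{-α})`, `K = Θ̃(N^β)`, `p / q → c`. -/
structure PDSRegime (c α β : ℝ) (N K : ℕ → ℕ) (p q : ℕ → unitInterval) : Prop where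
  tendsto_N : Tendsto N atTop atTop
  K_pos : ∀ n, 0 < K n
  K_le : ∀ n, K n ≤ N n
  q_pos : ∀ n, 0 < q n
  rate_q : Tendsto (fun n => Real.log ((q n : ℝ)⁻¹) / Real.log (N n)) atTop (𝓝 α)
  rate_K : Tendsto (fun n => Real.log (K n) / Real.log (N n)) atTop (𝓝 β)
  ratio : Tendsto (fun n => (p n : ℝ) / (q n : ℝ)) atTop (𝓝 c)

end

/-! Lower bound. Planted clique on `m` vertices with density `γ` is blown up to planted dense
subgraph on `N = mL` vertices: every vertex gets `L` copies, so a clique of size `k` becomes a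
planted set of size `kL`, and each pair of distinct base vertices governs a block of at most `L²`
pairs. A block is resampled with density `f` relative to the product law of mean `q` if its base
pair is an edge, and with density `(1 - γ f) / (1 - γ)` if it is not. The mixture over the base edge
is exactly the product law, so `G(m, γ)` is sent to `G(N, q)` without error.

Under the alternative the clique blocks have density `f`, which should be the likelihood ratio of
mean `cq` against mean `q`. This ratio is unbounded, while the second density requires `γ f ≤ 1`. So
`f` is the ratio truncated at `W` open pairs (hence at most `c ^ W`), plus a constant restoring
total mass one. If `cqL² ≤ n^{-ε}`, truncation loses `O(n^{-ε(W+1)})` per block, negligible over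
`k²` blocks for a large constant `W`. Thus `γ` is a constant, but possibly a small one; this is why
the conjecture is used at every density up to `1/2` (`blockDefect_le`,
`bernExp_mul_prod_openDensity_le`, `sum_seedWeight_bernExp`).

Pairs of copies of one base vertex have no base pair and keep mean `q` even inside the planted set.
This defect is hidden by a random labelling: permuting the planted labels separately in each layer
of copies fixes the planted set but randomizes the set `M` of defective pairs. The chi-square cost
is governed by the mean of `exp(2cq |M ∩ M'|)` for two independent copies. The intersection is
bounded by fixed-point counts of uniform permutations, whose exponential moments give a cost of
order `cqL² log k` (`sum_sum_exp_agreeCount_le`, `avg_bernExp_sdiff_le`,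
`card_mergedPairs_inter_le`). The random labelling also makes the planted set uniform.

Tests are non-uniform circuits, so the labelling and the resampled configurations can be fixed at
values no worse than average; each edge query then costs at most two instructions
(`exists_errorPC_le`). With `L = n^t`, `k = n^κ`, `q = n^{-s}`, the constraints `κ < 1/2` and `2t <
s` give `β = (κ + t)/(1 + t)`, `α = s/(1 + t)`, which reaches every `β < 1/2 + α/4`.

Upper bound. Count edges and threshold halfway between the two means. Chebyshev bounds the error by
a constant times `N²/(K⁴ q)`, which vanishes if `2 - 4β + α < 0`. A unary counter makes this a
polynomial-size circuit. -/

set_option linter.unusedSectionVars false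

/-! ### Products of Bernoulli laws on a finite index set -/

section Bernoulli

variable {ι β : Type*} [Fintype ι] [DecidableEq ι]

/-- The weight of the configuration `ω` under independent Bernoulli variables of means `ρ`. -/
noncomputable def bernWeight (ρ : ι → ℝ) (ω : ι → Bool) : ℝ :=
  ∏ x, if ω x then ρ x else 1 - ρ x

/-- Expectation under independent Bernoulli variables of means `ρ`. -/
noncomputable def bernExp (ρ : ι → ℝ) (f : (ι → Bool) → ℝ) : ℝ :=
  ∑ ω, bernWeight ρ ω * f ω

/-- The configuration that agrees with `ω` on `D` and with `ω'` elsewhere. -/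
def splice {α : Type*} (D : ι → Bool) (ω ω' : ι → α) : ι → α := fun x => if D x then ω x else ω' x

theorem splice_splice_left {α : Type*} (D : ι → Bool) (ω ω' : ι → α) :
    splice D (splice D ω ω') (splice D ω' ω) = ω := by
  funext x; simp only [splice]; split_ifs <;> rfl

theorem bernExp_prod (ρ : ι → ℝ) (h : ι → Bool → ℝ) :
    bernExp ρ (fun ω => ∏ x, h x (ω x)) = ∏ x, (ρ x * h x true + (1 - ρ x) * h x false) := by
  have := Finset.prod_univ_sum (fun _ : ι => (Finset.univ : Finset Bool))
    (fun x b => (if b then ρ x else 1 - ρ x) * h x b)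
  simp only [Fintype.piFinset_univ, Fintype.sum_bool, if_true] at this
  simp only [Bool.false_eq_true, if_false] at this
  rw [this, bernExp]
  exact Finset.sum_congr rfl fun ω _ => by rw [bernWeight, Finset.prod_mul_distrib]

theorem bernExp_one (ρ : ι → ℝ) : bernExp ρ (fun _ => 1) = 1 := by
  have := bernExp_prod ρ (fun _ _ => 1)
  simpa using this

theorem bernExp_add (ρ : ι → ℝ) (f g : (ι → Bool) → ℝ) :
    bernExp ρ (fun ω => f ω + g ω) = bernExp ρ f + bernExp ρ g := by
  simp [bernExp, mul_add, Finset.sum_add_distrib]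

theorem bernExp_sub (ρ : ι → ℝ) (f g : (ι → Bool) → ℝ) :
    bernExp ρ (fun ω => f ω - g ω) = bernExp ρ f - bernExp ρ g := by
  simp [bernExp, mul_sub, Finset.sum_sub_distrib]

theorem bernExp_const_mul (ρ : ι → ℝ) (a : ℝ) (f : (ι → Bool) → ℝ) :
    bernExp ρ (fun ω => a * f ω) = a * bernExp ρ f := by
  simp only [bernExp, Finset.mul_sum]
  exact Finset.sum_congr rfl fun _ _ => by ring

theorem bernExp_const (ρ : ι → ℝ) (a : ℝ) : bernExp ρ (fun _ => a) = a := by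
  simpa [bernExp_one] using bernExp_const_mul ρ a (fun _ => 1)

theorem bernExp_sum {κ : Type*} (ρ : ι → ℝ) (s : Finset κ) (f : κ → (ι → Bool) → ℝ) :
    bernExp ρ (fun ω => ∑ j ∈ s, f j ω) = ∑ j ∈ s, bernExp ρ (f j) := by
  simp only [bernExp, Finset.mul_sum]
  exact Finset.sum_comm

theorem bernWeight_nonneg {ρ : ι → ℝ} (h0 : ∀ x, 0 ≤ ρ x) (h1 : ∀ x, ρ x ≤ 1) (ω : ι → Bool) :
    0 ≤ bernWeight ρ ω :=
  Finset.prod_nonneg fun x _ => by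
    split_ifs
    · exact h0 x
    · linarith [h1 x]

theorem bernExp_mono {ρ : ι → ℝ} (h0 : ∀ x, 0 ≤ ρ x) (h1 : ∀ x, ρ x ≤ 1)
    {f g : (ι → Bool) → ℝ} (h : ∀ ω, f ω ≤ g ω) : bernExp ρ f ≤ bernExp ρ g :=
  Finset.sum_le_sum fun ω _ => mul_le_mul_of_nonneg_left (h ω) (bernWeight_nonneg h0 h1 ω)

theorem bernExp_nonneg {ρ : ι → ℝ} (h0 : ∀ x, 0 ≤ ρ x) (h1 : ∀ x, ρ x ≤ 1)
    {f : (ι → Bool) → ℝ} (h : ∀ ω, 0 ≤ f ω) : 0 ≤ bernExp ρ f :=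
  Finset.sum_nonneg fun ω _ => mul_nonneg (bernWeight_nonneg h0 h1 ω) (h ω)

theorem bernWeight_splice (D : ι → Bool) (ρ ρ' : ι → ℝ) (ω ω' : ι → Bool) :
    bernWeight (splice D ρ ρ') (splice D ω ω') * bernWeight (splice D ρ' ρ) (splice D ω' ω) =
      bernWeight ρ ω * bernWeight ρ' ω' := by
  simp only [bernWeight, ← Finset.prod_mul_distrib]
  refine Finset.prod_congr rfl fun x _ => ?_
  by_cases h : D x = true
  · simp [splice, h]
  · simp only [splice, h]
    exact mul_comm _ _

/-- Exchanging the coordinates outside `D` between two independent configurations. -/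
theorem sum_sum_bernWeight_splice (D : ι → Bool) (ρ ρ' : ι → ℝ)
    (F : (ι → Bool) → (ι → Bool) → ℝ) :
    ∑ ω, ∑ ω', bernWeight ρ ω * bernWeight ρ' ω' * F ω ω' =
      ∑ ω, ∑ ω', bernWeight (splice D ρ ρ') ω * bernWeight (splice D ρ' ρ) ω' *
        F (splice D ω ω') (splice D ω' ω) := by
  rw [← Finset.sum_product', ← Finset.sum_product']
  refine Finset.sum_nbij' (fun p => (splice D p.1 p.2, splice D p.2 p.1))
    (fun p => (splice D p.1 p.2, splice D p.2 p.1)) (by simp) (by simp) ?_ ?_ ?_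
  · rintro ⟨ω, ω'⟩ _; simp [splice_splice_left]
  · rintro ⟨ω, ω'⟩ _; simp [splice_splice_left]
  · rintro ⟨ω, ω'⟩ _
    simp only [splice_splice_left, bernWeight_splice]

/-- Gluing two independent configurations gives a configuration with glued means. -/
theorem sum_sum_bernWeight_glue (D : ι → Bool) (ρ ρ' : ι → ℝ) (f : (ι → Bool) → ℝ) :
    ∑ ω, ∑ ω', bernWeight ρ ω * bernWeight ρ' ω' * f (splice D ω ω') =
      bernExp (splice D ρ ρ') f := by
  rw [sum_sum_bernWeight_splice D]
  simp only [splice_splice_left, bernExp]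
  refine Finset.sum_congr rfl fun ω _ => ?_
  have := bernExp_one (splice D ρ' ρ)
  simp only [bernExp, mul_one] at this
  rw [← Finset.sum_mul, ← Finset.mul_sum, this, mul_one]

/-- `f` depends only on the coordinates in `D`. -/
def DependsOnly (D : ι → Prop) (f : (ι → Bool) → ℝ) : Prop :=
  ∀ ω ω', (∀ x, D x → ω x = ω' x) → f ω = f ω'

-- Independence from a symmetry: exchanging the coordinates outside `D` between two independent
-- copies preserves their joint law, and turns `f ω * g ω'` into `f ω * g ω`.
open Classical in
theorem bernExp_mul_of_dependsOnly (ρ : ι → ℝ) (D : ι → Prop) {f g : (ι → Bool) → ℝ}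
    (hf : DependsOnly D f) (hg : DependsOnly (fun x => ¬ D x) g) :
    bernExp ρ (fun ω => f ω * g ω) = bernExp ρ f * bernExp ρ g := by
  have key := sum_sum_bernWeight_splice (fun x => decide (D x)) ρ ρ (fun ω ω' => f ω * g ω')
  have hs : splice (fun x => decide (D x)) ρ ρ = ρ := by funext x; simp [splice]
  have h1 : ∀ ω ω', f (splice (fun x => decide (D x)) ω ω') = f ω := fun ω ω' =>
    hf _ _ fun x hx => by simp [splice, hx]
  have h2 : ∀ ω ω', g (splice (fun x => decide (D x)) ω' ω) = g ω := fun ω ω' =>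
    hg _ _ fun x hx => by simp [splice, hx]
  simp only [hs, h1, h2] at key
  have hone := bernExp_one ρ
  simp only [bernExp, mul_one] at hone
  have hl : ∑ ω, ∑ ω', bernWeight ρ ω * bernWeight ρ ω' * (f ω * g ω') =
      bernExp ρ f * bernExp ρ g := by
    simp only [bernExp, Finset.sum_mul_sum]
    exact Finset.sum_congr rfl fun _ _ => Finset.sum_congr rfl fun _ _ => by ring
  have hr : ∑ ω, ∑ ω', bernWeight ρ ω * bernWeight ρ ω' * (f ω * g ω) =
      bernExp ρ (fun ω => f ω * g ω) := by
    simp only [bernExp]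
    refine Finset.sum_congr rfl fun ω _ => ?_
    rw [← Finset.sum_mul, ← Finset.mul_sum, hone, mul_one]
  rw [← hl, ← hr, key]

theorem DependsOnly.prod {κ : Type*} {D : ι → Prop} (s : Finset κ) {f : κ → (ι → Bool) → ℝ}
    (h : ∀ j ∈ s, DependsOnly D (f j)) : DependsOnly D (fun ω => ∏ j ∈ s, f j ω) :=
  fun ω ω' hω => Finset.prod_congr rfl fun j hj => h j hj ω ω' hω

theorem DependsOnly.mono {D D' : ι → Prop} {f : (ι → Bool) → ℝ} (hD : ∀ x, D x → D' x)
    (h : DependsOnly D f) : DependsOnly D' f :=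
  fun ω ω' hω => h ω ω' fun x hx => hω x (hD x hx)

/-- Functions of disjoint blocks of coordinates are independent. -/
theorem bernExp_prod_blocks [DecidableEq β] (ρ : ι → ℝ) (b : ι → β) (s : Finset β)
    (h : β → (ι → Bool) → ℝ) (hh : ∀ B ∈ s, DependsOnly (fun x => b x = B) (h B)) :
    bernExp ρ (fun ω => ∏ B ∈ s, h B ω) = ∏ B ∈ s, bernExp ρ (h B) := by
  induction s using Finset.induction_on with
  | empty => simp [bernExp_one]
  | insert B s hB ih =>
    simp only [Finset.prod_insert hB]
    rw [bernExp_mul_of_dependsOnly ρ (fun x => b x = B) (hh B (by simp)),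
      ih fun B' hB' => hh B' (by simp [hB'])]
    refine DependsOnly.prod s fun B' hB' => (hh B' (by simp [hB'])).mono ?_
    rintro x rfl h
    exact hB (h ▸ hB')

theorem bernExp_sq_le {ρ : ι → ℝ} (h0 : ∀ x, 0 ≤ ρ x) (h1 : ∀ x, ρ x ≤ 1)
    (f g : (ι → Bool) → ℝ) :
    bernExp ρ (fun ω => f ω * g ω) ^ 2 ≤
      bernExp ρ (fun ω => f ω ^ 2) * bernExp ρ (fun ω => g ω ^ 2) := by
  have := Finset.sum_mul_sq_le_sq_mul_sq Finset.univ
    (fun ω => Real.sqrt (bernWeight ρ ω) * f ω) (fun ω => Real.sqrt (bernWeight ρ ω) * g ω)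
  have hs : ∀ ω, Real.sqrt (bernWeight ρ ω) ^ 2 = bernWeight ρ ω :=
    fun ω => Real.sq_sqrt (bernWeight_nonneg h0 h1 ω)
  have hc : ∀ ω, Real.sqrt (bernWeight ρ ω) * f ω * (Real.sqrt (bernWeight ρ ω) * g ω) =
      bernWeight ρ ω * (f ω * g ω) := fun ω => by
    rw [← hs ω, Real.sqrt_sq (Real.sqrt_nonneg _)]; ring
  simp only [hc, mul_pow, hs] at this
  exact this

/-- Change of measure: a product density turns one product law into another. -/
theorem bernWeight_mul_prod (ρ ρ' : ι → ℝ) (r : ι → Bool → ℝ)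
    (ht : ∀ x, ρ x * r x true = ρ' x) (hf : ∀ x, (1 - ρ x) * r x false = 1 - ρ' x)
    (ω : ι → Bool) : bernWeight ρ ω * ∏ x, r x (ω x) = bernWeight ρ' ω := by
  simp only [bernWeight, ← Finset.prod_mul_distrib]
  refine Finset.prod_congr rfl fun x _ => ?_
  cases h : ω x
  · simpa using hf x
  · simpa using ht x

/-- The indicator of an open coordinate. -/
def bit (b : Bool) : ℝ := if b then 1 else 0

/-- Distinct coordinates are uncorrelated and each has variance `ρ x * (1 - ρ x) ≤ ρ x`. The means
may vary, so the bound serves both the null law and the law with a fixed planted set. -/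
theorem bernExp_variance_le (ρ : ι → ℝ) (s : Finset ι) :
    bernExp ρ (fun ω => (∑ x ∈ s, bit (ω x) - ∑ x ∈ s, ρ x) ^ 2) ≤ ∑ x ∈ s, ρ x := by
  have hexp : ∀ ω : ι → Bool, (∑ x ∈ s, bit (ω x) - ∑ x ∈ s, ρ x) ^ 2 =
      ∑ x ∈ s, ∑ y ∈ s, (bit (ω x) - ρ x) * (bit (ω y) - ρ y) := fun ω => by
    rw [← Finset.sum_sub_distrib, sq, Finset.sum_mul_sum]
  have hmean : ∀ x, bernExp ρ (fun ω => bit (ω x) - ρ x) = 0 := fun x => by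
    have := bernExp_prod ρ (fun y b => if y = x then bit b - ρ x else 1)
    simp only [Finset.prod_ite_eq', Finset.mem_univ, if_true] at this
    rw [this, Finset.prod_eq_zero (Finset.mem_univ x)]
    simp [bit]; ring
  simp only [hexp]
  rw [bernExp_sum]
  refine Finset.sum_le_sum fun x hx => ?_
  rw [bernExp_sum, Finset.sum_eq_single_of_mem x hx]
  · have : ∀ ω : ι → Bool, (bit (ω x) - ρ x) * (bit (ω x) - ρ x) =
        (1 - 2 * ρ x) * (bit (ω x) - ρ x) + ρ x * (1 - ρ x) := fun ω => by
      cases ω x <;> simp [bit] <;> ring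
    simp only [this]
    rw [bernExp_add, bernExp_const_mul, hmean, bernExp_const]
    nlinarith [sq_nonneg (ρ x)]
  · intro y _ hy
    rw [bernExp_mul_of_dependsOnly ρ (fun z => z = x), hmean, zero_mul]
    · intro ω ω' h; simp [h x rfl]
    · intro ω ω' h; simp [h y hy]

end Bernoulli

/-! ### Random graphs as Bernoulli configurations -/

section Graphs

/-- The graph whose edges are the non-diagonal open pairs of a configuration. -/
def configGraph {V : Type*} (ω : Sym2 V → Bool) : SimpleGraph V where
  Adj i j := i ≠ j ∧ ω s(i, j) = true
  symm := ⟨fun i j h => ⟨h.1.symm, by rw [Sym2.eq_swap]; exact h.2⟩⟩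
  loopless := ⟨fun _ h => h.1 rfl⟩

-- Diagonal coordinates are invisible to the graph. The fibres of `configGraph` are therefore boxes
-- with free diagonal factors, which sum to one.
open Classical in
theorem configGraph_eq_iff {V : Type*} (ω : Sym2 V → Bool) (G : SimpleGraph V) :
    configGraph ω = G ↔ ∀ e : Sym2 V, ¬ e.IsDiag → ω e = decide (e ∈ G.edgeSet) := by
  constructor
  · rintro rfl e he
    induction e using Sym2.ind with
    | _ i j =>
      rw [Sym2.mk_isDiag_iff] at he
      simp [configGraph, he]
  · intro h
    ext i j
    by_cases hij : i = j
    · subst hij; simp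
    · have := h s(i, j) (by simpa using hij)
      simp [configGraph, hij, this]

instance {n : ℕ} : MeasurableSingletonClass (SimpleGraph (Fin n)) where
  measurableSet_singleton G := by
    have : ({G} : Set (SimpleGraph (Fin n))) = SimpleGraph.edgeSet ⁻¹' {G.edgeSet} := by
      ext H; simp
    rw [this]
    exact SimpleGraph.measurable_edgeSet (measurableSet_singleton _)

theorem integral_simpleGraph {n : ℕ} (μ : Measure (SimpleGraph (Fin n))) [IsFiniteMeasure μ]
    (f : SimpleGraph (Fin n) → ℝ) : ∫ G, f G ∂μ = ∑ G, μ.real {G} * f G := by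
  rw [integral_fintype (Integrable.of_finite)]
  simp

open Classical in
theorem sum_bernWeight_fiber {n : ℕ} (p : ℝ) (G : SimpleGraph (Fin n)) :
    ∑ ω with configGraph ω = G, bernWeight (fun _ => p) ω =
      ∏ e : Sym2 (Fin n) with ¬ e.IsDiag, if e ∈ G.edgeSet then p else 1 - p := by
  have h := Finset.prod_univ_sum
    (fun e : Sym2 (Fin n) => if e.IsDiag then (Finset.univ : Finset Bool)
      else {decide (e ∈ G.edgeSet)}) (fun _ b => if b then p else 1 - p)
  have hset : Fintype.piFinset (fun e : Sym2 (Fin n) => if e.IsDiag then (Finset.univ : Finset Bool)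
      else {decide (e ∈ G.edgeSet)}) = Finset.univ.filter fun ω => configGraph ω = G := by
    ext ω
    simp only [Fintype.mem_piFinset, Finset.mem_filter, Finset.mem_univ, true_and,
      configGraph_eq_iff]
    refine forall_congr' fun e => ?_
    by_cases he : e.IsDiag <;> simp [he]
  rw [hset] at h
  simp only [bernWeight]
  rw [← h, Finset.prod_filter]
  refine Finset.prod_congr rfl fun e _ => ?_
  by_cases he : e.IsDiag <;> simp [he]

open Classical in
theorem binomialRandom_real_singleton {n : ℕ} (p : unitInterval) (G : SimpleGraph (Fin n)) :
    (SimpleGraph.binomialRandom (Fin n) p).real {G} =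
      ∏ e : Sym2 (Fin n) with ¬ e.IsDiag, if e ∈ G.edgeSet then (p : ℝ) else 1 - p := by
  rw [Measure.real, SimpleGraph.binomialRandom_singleton, Finset.prod_ite, Finset.prod_const,
    Finset.prod_const]
  have h1 : (Finset.filter (fun e : Sym2 (Fin n) => e ∈ G.edgeSet)
      (Finset.univ.filter fun e => ¬ e.IsDiag)).card = G.edgeSet.ncard := by
    rw [← Set.ncard_coe_finset]
    congr 1
    ext e
    simpa using fun h => G.not_isDiag_of_mem_edgeSet h
  have h2 := Finset.card_filter_add_card_filter_not
    (s := Finset.univ.filter fun e : Sym2 (Fin n) => ¬ e.IsDiag) (fun e => e ∈ G.edgeSet)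
  have h3 : (Finset.univ.filter fun e : Sym2 (Fin n) => ¬ e.IsDiag).card = n.choose 2 := by
    have := Sym2.card_subtype_not_diag (α := Fin n)
    rwa [Fintype.card_subtype, Fintype.card_fin] at this
  rw [h1] at h2 ⊢
  rw [h3] at h2
  have h4 : (Finset.filter (fun e : Sym2 (Fin n) => ¬ e ∈ G.edgeSet)
      (Finset.univ.filter fun e => ¬ e.IsDiag)).card = n.choose 2 - G.edgeSet.ncard := by omega
  rw [h4]
  simp [ENNReal.toReal_mul, ENNReal.toReal_pow]

/-- Expectations under `G(n, p)` as expectations over Bernoulli configurations. -/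
theorem integral_binomialRandom {n : ℕ} (p : unitInterval) (f : SimpleGraph (Fin n) → ℝ) :
    ∫ G, f G ∂(SimpleGraph.binomialRandom (Fin n) p) =
      bernExp (fun _ => (p : ℝ)) (fun ω => f (configGraph ω)) := by
  classical
  rw [integral_simpleGraph, bernExp, ← Finset.sum_fiberwise Finset.univ configGraph]
  refine Finset.sum_congr rfl fun G _ => ?_
  rw [binomialRandom_real_singleton, ← sum_bernWeight_fiber, Finset.sum_mul]
  refine Finset.sum_congr rfl fun ω hω => ?_
  rw [(Finset.mem_filter.mp hω).2]

theorem integral_uniformMixture {n k : ℕ} (μ : Finset (Fin n) → Measure (SimpleGraph (Fin n)))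
    [∀ S, IsFiniteMeasure (μ S)] (f : SimpleGraph (Fin n) → ℝ) :
    ∫ G, f G ∂(uniformMixture n k μ) =
      ((n.choose k : ℝ))⁻¹ * ∑ S ∈ Finset.powersetCard k Finset.univ, ∫ G, f G ∂(μ S) := by
  rw [uniformMixture, integral_smul_measure, integral_finsetSum_measure]
  · simp
  · exact fun _ _ => Integrable.of_finite

theorem integral_plantedClique {n k : ℕ} (p : unitInterval) (f : SimpleGraph (Fin n) → ℝ) :
    ∫ G, f G ∂(plantedClique n k p) =
      ((n.choose k : ℝ))⁻¹ * ∑ S ∈ Finset.powersetCard k Finset.univ,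
        bernExp (fun _ => (p : ℝ)) (fun ω => f (configGraph ω ⊔ cliqueOn S)) := by
  have : ∀ S : Finset (Fin n), IsFiniteMeasure
      ((SimpleGraph.binomialRandom (Fin n) p).map (fun G => G ⊔ cliqueOn S)) := fun S =>
    inferInstance
  rw [plantedClique, integral_uniformMixture]
  congr 1
  refine Finset.sum_congr rfl fun S _ => ?_
  rw [integral_map (measurable_of_finite _).aemeasurable
    (measurable_of_finite f).aestronglyMeasurable, integral_binomialRandom]

open Classical in
/-- The edge probabilities when the planted set is `S`. -/
noncomputable def plantedProb {n : ℕ} (S : Finset (Fin n)) (p q : ℝ) : Sym2 (Fin n) → ℝ :=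
  fun e => if ∀ i ∈ e, i ∈ S then p else q

theorem integral_plantedDense {n k : ℕ} (p q : unitInterval) (f : SimpleGraph (Fin n) → ℝ) :
    ∫ G, f G ∂(plantedDense n k p q) =
      ((n.choose k : ℝ))⁻¹ * ∑ S ∈ Finset.powersetCard k Finset.univ,
        bernExp (plantedProb S (p : ℝ) q) (fun ω => f (configGraph ω)) := by
  classical
  have : ∀ S : Finset (Fin n), IsFiniteMeasure
      (((SimpleGraph.binomialRandom (Fin n) p).prod (SimpleGraph.binomialRandom (Fin n) q)).map
      (fun AB => glueGraph S AB.1 AB.2)) := fun S => inferInstance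
  rw [plantedDense, integral_uniformMixture]
  congr 1
  refine Finset.sum_congr rfl fun S _ => ?_
  rw [integral_map (measurable_of_finite _).aemeasurable
    (measurable_of_finite f).aestronglyMeasurable, integral_prod _ Integrable.of_finite,
    integral_binomialRandom]
  simp only [integral_binomialRandom]
  have hs : plantedProb S (p : ℝ) q =
      splice (fun e : Sym2 (Fin n) => decide (∀ i ∈ e, i ∈ S)) (fun _ => (p : ℝ))
        (fun _ => (q : ℝ)) := by
    funext e; simp [plantedProb, splice]
  rw [hs, ← sum_sum_bernWeight_glue, bernExp]
  refine Finset.sum_congr rfl fun ω _ => ?_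
  rw [bernExp, Finset.mul_sum]
  refine Finset.sum_congr rfl fun ω' _ => ?_
  rw [mul_assoc]
  congr 3
  ext i j
  by_cases h : i ∈ S ∧ j ∈ S 
  · simp [glueGraph, configGraph, splice, h]
  · simp only [glueGraph, configGraph, splice, h]
    simp [h]

end Graphs

/-! ### Pulling back tests along local graph maps -/

section Pullback

variable {n N : ℕ}

/-- The graph on `N` vertices in which `x` and `y` are joined according to `H₁` if `π x` and `π y`
are adjacent in `G`, and according to `H₀` otherwise. -/
def pullGraph (π : Fin N → Fin n) (H₁ H₀ : Sym2 (Fin N) → Bool) (G : SimpleGraph (Fin n)) :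
    SimpleGraph (Fin N) where
  Adj x y := x ≠ y ∧ ((G.Adj (π x) (π y) ∧ H₁ s(x, y) = true) ∨
    (¬ G.Adj (π x) (π y) ∧ H₀ s(x, y) = true))
  symm := ⟨fun x y h => ⟨h.1.symm, by rw [Sym2.eq_swap, G.adj_comm]; exact h.2⟩⟩
  loopless := ⟨fun _ h => h.1 rfl⟩

/-- Instructions on the input graph `G` that simulate an instruction on `pullGraph π H₁ H₀ G`. -/
def Instr.pull {r : ℕ} (π : Fin N → Fin n) (H₁ H₀ : Sym2 (Fin N) → Bool) :
    Instr N r → List (Instr n r)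
  | .const d b => [.const d b]
  | .coin d s => [.coin d s]
  | .nand d a b => [.nand d a b]
  | .edge d x y =>
    if x = y then [.const d false]
    else if H₁ s(x, y) then
      if H₀ s(x, y) then [.const d true] else [.edge d (π x) (π y)]
    else
      -- NAND of a register with itself negates the edge bit: this is the only case with two
      -- instructions.
      if H₀ s(x, y) then [.edge d (π x) (π y), .nand d d d] else [.const d false]

theorem Instr.length_pull_le {r : ℕ} (π : Fin N → Fin n) (H₁ H₀ : Sym2 (Fin N) → Bool)
    (I : Instr N r) : (I.pull π H₁ H₀).length ≤ 2 := by
  cases I <;> simp only [Instr.pull] <;> (try split_ifs) <;> simp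

theorem Instr.foldl_pull {r : ℕ} (π : Fin N → Fin n) (H₁ H₀ : Sym2 (Fin N) → Bool)
    (G : SimpleGraph (Fin n)) (ω : Fin r → Bool) (v : ℕ → Bool) (I : Instr N r) :
    (I.pull π H₁ H₀).foldl (Instr.exec G ω) v = I.exec (pullGraph π H₁ H₀ G) ω v := by
  cases I with
  | const d b => rfl
  | coin d s => rfl
  | nand d a b => rfl
  | edge d x y =>
    by_cases hxy : x = y
    · simp [Instr.pull, Instr.exec, pullGraph, hxy]
    · have hA : (pullGraph π H₁ H₀ G).Adj x y ↔ ((G.Adj (π x) (π y) ∧ H₁ s(x, y) = true) ∨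
          (¬ G.Adj (π x) (π y) ∧ H₀ s(x, y) = true)) := by simp [pullGraph, hxy]
      cases h1 : H₁ s(x, y) <;> cases h0 : H₀ s(x, y) <;> by_cases hG : G.Adj (π x) (π y) <;>
        simp [Instr.pull, Instr.exec, hA, hxy, h1, h0, hG]

/-- The test `φ` applied to `pullGraph π H₁ H₀ G`, as a test on `G`. -/
def RandomizedTest.pull (φ : RandomizedTest N) (π : Fin N → Fin n)
    (H₁ H₀ : Sym2 (Fin N) → Bool) : RandomizedTest n where
  coins := φ.coins
  prog := φ.prog.flatMap (Instr.pull π H₁ H₀)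

theorem RandomizedTest.cost_pull_le (φ : RandomizedTest N) (π : Fin N → Fin n)
    (H₁ H₀ : Sym2 (Fin N) → Bool) : (φ.pull π H₁ H₀).cost ≤ 2 * φ.cost := by
  have : ∀ l : List (Instr N φ.coins), (l.flatMap (Instr.pull π H₁ H₀)).length ≤ 2 * l.length := by
    intro l
    induction l with
    | nil => simp
    | cons I l ih =>
      have := I.length_pull_le π H₁ H₀
      simp only [List.flatMap_cons, List.length_append, List.length_cons]
      omega
  have := this φ.prog
  simp only [RandomizedTest.cost, RandomizedTest.pull]
  omega

theorem RandomizedTest.acceptProb_pull (φ : RandomizedTest N) (π : Fin N → Fin n)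
    (H₁ H₀ : Sym2 (Fin N) → Bool) (G : SimpleGraph (Fin n)) :
    (φ.pull π H₁ H₀).acceptProb G = φ.acceptProb (pullGraph π H₁ H₀ G) := by
  have : ∀ (l : List (Instr N φ.coins)) (ω : Fin φ.coins → Bool) (v : ℕ → Bool),
      (l.flatMap (Instr.pull π H₁ H₀)).foldl (Instr.exec G ω) v =
        l.foldl (Instr.exec (pullGraph π H₁ H₀ G) ω) v := by
    intro l ω
    induction l with
    | nil => intro v; rfl
    | cons I l ih =>
      intro v
      simp only [List.flatMap_cons, List.foldl_append, List.foldl_cons, Instr.foldl_pull, ih]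
  simp only [RandomizedTest.acceptProb, RandomizedTest.pull, RandomizedTest.run, this]
  rfl

theorem RandomizedTest.acceptProb_nonneg (φ : RandomizedTest n) (G : SimpleGraph (Fin n)) :
    0 ≤ φ.acceptProb G := by
  unfold RandomizedTest.acceptProb; positivity

theorem RandomizedTest.acceptProb_le_one (φ : RandomizedTest n) (G : SimpleGraph (Fin n)) :
    φ.acceptProb G ≤ 1 := by
  unfold RandomizedTest.acceptProb
  rw [div_le_one (by positivity)]
  have := Finset.card_filter_le (Finset.univ : Finset (Fin φ.coins → Bool))
    (fun ω => φ.run G ω = true)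
  rw [Finset.card_univ, Fintype.card_fun, Fintype.card_bool, Fintype.card_fin] at this
  exact_mod_cast this

end Pullback

/-! ### A polynomial-size circuit for edge counting -/

section Counting

variable {n : ℕ}

open Classical in
/-- The number of pairs in a list that are edges. -/
noncomputable def edgeCount (G : SimpleGraph (Fin n)) (l : List (Fin n × Fin n)) : ℕ :=
  l.countP fun e => decide (G.Adj e.1 e.2)

/-- Registers `3, …, T + 3` hold a unary counter, register `2` an edge indicator: replace the
counter bit `j + 1` by its disjunction with the conjunction of bit `j` and the edge indicator. -/
def counterStep (j : ℕ) : List (Instr n 0) :=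
  [.nand 0 (j + 4) (j + 4), .nand 1 (j + 3) 2, .nand (j + 4) 0 1]

/-- Update the counter bits `T, T - 1, …, 1` in this order. -/
def counterSweep : ℕ → List (Instr n 0)
  | 0 => []
  | T + 1 => counterStep T ++ counterSweep T

/-- Process all pairs of a list. -/
def countProgram (T : ℕ) (l : List (Fin n × Fin n)) : List (Instr n 0) :=
  l.flatMap fun e => .edge 2 e.1 e.2 :: counterSweep T

/-- The test that accepts if at least `T` pairs of the list `l` are edges. -/
def countTest (T : ℕ) (l : List (Fin n × Fin n)) : RandomizedTest n where
  coins := 0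
  -- Counter bit `0` stays `true` ("at least zero edges"). The final two NANDs copy counter bit `T`
  -- to the output register.
  prog := .const 3 true :: (countProgram T l ++ [.nand 0 (T + 3) (T + 3), .nand 0 0 0])

theorem length_counterSweep (T : ℕ) : (counterSweep (n := n) T).length = 3 * T := by
  induction T with
  | zero => rfl
  | succ T ih => simp [counterSweep, counterStep, ih]; ring

theorem cost_countTest (T : ℕ) (l : List (Fin n × Fin n)) :
    (countTest T l).cost = l.length * (3 * T + 1) + 3 := by
  simp [RandomizedTest.cost, countTest, countProgram, List.length_flatMap, length_counterSweep]

/-- The descending order matters: when bit `j + 1` is rewritten, bit `j` still has its old value, so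
one edge advances the counter by one only. Registers `0` and `1` are scratch, hence the restriction
to `2 ≤ m`. -/
theorem foldl_counterSweep (G : SimpleGraph (Fin n)) (ω : Fin 0 → Bool) (T : ℕ) (v : ℕ → Bool) :
    ∀ m, 2 ≤ m → (counterSweep T).foldl (Instr.exec G ω) v m =
      if 4 ≤ m ∧ m < T + 4 then (v m || (v (m - 1) && v 2)) else v m := by
  induction T generalizing v with
  | zero => intro m hm; simp [counterSweep]
  | succ T ih =>
    intro m hm
    simp only [counterSweep, List.foldl_append]
    rw [ih _ m hm]
    simp only [counterStep, List.foldl_cons, List.foldl_nil, Instr.exec]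
    by_cases h : m = T + 4
    · subst h
      simp
    · have e1 : m ≠ 0 := by omega
      have e2 : m ≠ 1 := by omega
      have e3 : (4 ≤ m ∧ m < T + 4) ↔ (4 ≤ m ∧ m < T + 1 + 4) := by omega
      by_cases h4 : 4 ≤ m ∧ m < T + 4
      · have e4 : m - 1 ≠ T + 4 := by omega
        have e5 : m - 1 ≠ 0 := by omega
        have e6 : m - 1 ≠ 1 := by omega
        rw [if_pos h4, if_pos (e3.mp h4)]
        simp [h, e1, e2, e4, e5, e6]
      · rw [if_neg h4, if_neg (e3.not.mp h4)]
        simp [h, e1, e2]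

theorem foldl_countProgram (G : SimpleGraph (Fin n)) (ω : Fin 0 → Bool) (T : ℕ)
    (l : List (Fin n × Fin n)) (v : ℕ → Bool) (c : ℕ)
    (hv : ∀ j ≤ T, v (j + 3) = decide (j ≤ c)) :
    ∀ j ≤ T, (countProgram T l).foldl (Instr.exec G ω) v (j + 3) =
      decide (j ≤ c + edgeCount G l) := by
  classical
  induction l generalizing v c with
  | nil => simpa [countProgram, edgeCount] using hv
  | cons e l ih =>
    intro j hj
    have hstep : ∀ j ≤ T, (counterSweep T).foldl (Instr.exec G ω)
        (Instr.exec G ω v (.edge 2 e.1 e.2)) (j + 3) =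
          decide (j ≤ c + if G.Adj e.1 e.2 then 1 else 0) := by
      intro j hj
      rw [foldl_counterSweep G ω T _ _ (by omega)]
      cases j with
      | zero =>
        have := hv 0 (by omega)
        simp [Instr.exec] at this ⊢
        exact this
      | succ j =>
        have h1 := hv (j + 1) hj
        have h0 := hv j (by omega)
        have e1 : j + 1 + 3 - 1 = j + 3 := by omega
        rw [if_pos (by omega), e1]
        simp only [Instr.exec, Function.update_apply, show j + 1 + 3 ≠ 2 by omega,
          show j + 3 ≠ 2 by omega, if_false, if_true, h1, h0]
        by_cases hA : G.Adj e.1 e.2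
        · simp only [hA, decide_true, Bool.and_true, if_true]
          rw [Bool.eq_iff_iff]
          simp; omega
        · simp [hA]
    have := ih _ _ hstep j hj
    simp only [countProgram, List.flatMap_cons, List.foldl_append, List.foldl_cons] at this ⊢
    rw [this]
    simp only [edgeCount, List.countP_cons, decide_eq_true_eq]
    congr 2
    ring

theorem run_countTest (G : SimpleGraph (Fin n)) (T : ℕ) (l : List (Fin n × Fin n))
    (ω : Fin 0 → Bool) :
    (countTest T l).run G ω = decide (T ≤ edgeCount G l) := by
  have h := foldl_countProgram G ω T l (Instr.exec G ω (fun _ => false) (.const 3 true)) 0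
    (by intro j _; rcases j with _ | j <;> simp [Instr.exec]) T le_rfl
  simp only [zero_add] at h
  have hr : (countTest T l).run G ω = (([.nand 0 (T + 3) (T + 3), .nand 0 0 0] :
      List (Instr n 0)).foldl (Instr.exec G ω) ((countProgram T l).foldl (Instr.exec G ω)
        (Instr.exec G ω (fun _ => false) (.const 3 true)))) 0 :=
    congrFun List.foldl_append 0
  rw [hr]
  generalize (countProgram T l).foldl (Instr.exec G ω)
    (Instr.exec G ω (fun _ => false) (.const 3 true)) = v at h ⊢
  simp [Instr.exec, h]

open Classical in
theorem acceptProb_countTest (G : SimpleGraph (Fin n)) (T : ℕ) (l : List (Fin n × Fin n)) :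
    (countTest T l).acceptProb G = if T ≤ edgeCount G l then 1 else 0 := by
  have hc : (countTest T l).coins = 0 := rfl
  have hrun : ∀ ω : Fin (countTest T l).coins → Bool, (countTest T l).run G ω =
      decide (T ≤ edgeCount G l) := fun ω => run_countTest G T l ω
  simp only [RandomizedTest.acceptProb, hrun, decide_eq_true_eq]
  by_cases h : T ≤ edgeCount G l
  · simp [h, hc]
  · simp [h]

end Counting

/-! ### Exponential moments of numbers of fixed points -/

section FixedPoints

/-- The number of fixed points of a permutation. -/
def fixCount {σ : Type*} [Fintype σ] [DecidableEq σ] (e : Equiv.Perm σ) : ℕ :=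
  (Finset.univ.filter fun i => e i = i).card

theorem fixCount_decomposeFin_zero {k : ℕ} (e : Equiv.Perm (Fin k)) :
    fixCount (Equiv.Perm.decomposeFin.symm (0, e)) = 1 + fixCount e := by
  simp only [fixCount]
  rw [Fin.univ_succ, Finset.filter_cons, if_pos (by simp), Finset.card_cons, Finset.filter_map,
    Finset.card_map, add_comm]
  congr 2
  ext i
  simp

/-- The permutation coded by `(p, e)` is `e` on the successors followed by the swap of `0` and `p`.
For `p ≠ 0` the swap moves `0` and can only destroy fixed points of `e`. -/
theorem fixCount_decomposeFin_le {k : ℕ} (p : Fin (k + 1)) (hp : p ≠ 0) (e : Equiv.Perm (Fin k)) :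
    fixCount (Equiv.Perm.decomposeFin.symm (p, e)) ≤ fixCount e := by
  simp only [fixCount]
  rw [Fin.univ_succ, Finset.filter_cons, if_neg (by simpa using hp), Finset.filter_map,
    Finset.card_map]
  refine Finset.card_le_card fun i hi => ?_
  simp only [Finset.mem_filter, Finset.mem_univ, true_and, Function.comp,
    Function.Embedding.coeFn_mk, Equiv.Perm.decomposeFin_symm_apply_succ] at hi ⊢
  by_cases h : (e i).succ = p
  · rw [h, Equiv.swap_apply_right] at hi
    exact absurd hi.symm (Fin.succ_ne_zero _)
  · rw [Equiv.swap_apply_of_ne_of_ne (Fin.succ_ne_zero _) h] at hi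
    exact Fin.succ_injective _ hi

/-- Extending a permutation of `k` points by one point, one of the `k + 1` choices adds a fixed
point and the other `k` add none. The sum thus grows by a factor of at most `z + k`. -/
theorem sum_pow_fixCount_fin_le {z : ℝ} (hz : 1 ≤ z) (k : ℕ) :
    ∑ e : Equiv.Perm (Fin k), z ^ fixCount e ≤ ∏ j ∈ Finset.range k, (z + j) := by
  induction k with
  | zero => simp [fixCount]
  | succ k ih =>
    rw [← Equiv.sum_comp Equiv.Perm.decomposeFin.symm, Fintype.sum_prod_type_right,
      Finset.prod_range_succ]
    have : ∀ e : Equiv.Perm (Fin k),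
        ∑ p, z ^ fixCount (Equiv.Perm.decomposeFin.symm (p, e)) ≤ z ^ fixCount e * (z + k) := by
      intro e
      rw [Fin.sum_univ_succ, fixCount_decomposeFin_zero]
      have hle : ∑ i : Fin k, z ^ fixCount (Equiv.Perm.decomposeFin.symm (i.succ, e)) ≤
          ∑ _i : Fin k, z ^ fixCount e :=
        Finset.sum_le_sum fun i _ =>
          pow_le_pow_right₀ hz (fixCount_decomposeFin_le _ (Fin.succ_ne_zero _) e)
      rw [Finset.sum_const, Finset.card_univ, Fintype.card_fin, nsmul_eq_mul] at hle
      rw [pow_add, pow_one]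
      linarith
    refine (Finset.sum_le_sum fun e _ => this e).trans ?_
    rw [← Finset.sum_mul]
    exact mul_le_mul_of_nonneg_right ih (by positivity)

/-- Write `z + j = (j + 1)(1 + (z - 1)/(j + 1))` and use `1 + u ≤ exp u`; the exponents add up to a
harmonic sum. -/
theorem prod_add_le_factorial_mul_exp {z : ℝ} (hz : 1 ≤ z) (k : ℕ) :
    ∏ j ∈ Finset.range k, (z + j) ≤ k.factorial * Real.exp ((z - 1) * (1 + Real.log k)) := by
  have h1 : ∏ j ∈ Finset.range k, (z + j) ≤
      ∏ j ∈ Finset.range k, (((j + 1 : ℕ) : ℝ) * Real.exp ((z - 1) * ((j + 1 : ℕ) : ℝ)⁻¹)) := by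
    refine Finset.prod_le_prod (fun j _ => by positivity) fun j _ => ?_
    have hj : (0 : ℝ) < ((j + 1 : ℕ) : ℝ) := by positivity
    have := Real.add_one_le_exp ((z - 1) * ((j + 1 : ℕ) : ℝ)⁻¹)
    calc z + j = ((j + 1 : ℕ) : ℝ) * ((z - 1) * ((j + 1 : ℕ) : ℝ)⁻¹ + 1) := by
          field_simp; push_cast; ring
      _ ≤ _ := mul_le_mul_of_nonneg_left this hj.le
  refine h1.trans ?_
  rw [Finset.prod_mul_distrib, ← Real.exp_sum, ← Finset.mul_sum]
  have h2 : ∏ j ∈ Finset.range k, (((j + 1 : ℕ)) : ℝ) = k.factorial := by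
    rw [← Finset.prod_range_add_one_eq_factorial]; push_cast; rfl
  rw [h2]
  have h3 : ∑ j ∈ Finset.range k, ((j + 1 : ℕ) : ℝ)⁻¹ ≤ 1 + Real.log k := by
    have := harmonic_le_one_add_log k
    simpa [harmonic] using this
  gcongr

theorem sum_pow_fixCount_le {σ : Type*} [Fintype σ] [DecidableEq σ] {z : ℝ} (hz : 1 ≤ z) :
    ∑ e : Equiv.Perm σ, z ^ fixCount e ≤ (Fintype.card σ).factorial *
      Real.exp ((z - 1) * (1 + Real.log (Fintype.card σ))) := by
  refine le_trans (le_of_eq ?_) ((sum_pow_fixCount_fin_le hz (Fintype.card σ)).trans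
    (prod_add_le_factorial_mul_exp hz _))
  let ψ := Fintype.equivFin σ
  rw [← Equiv.sum_comp ψ.permCongr]
  refine Finset.sum_congr rfl fun e _ => ?_
  congr 1
  simp only [fixCount]
  refine Finset.card_bij (fun i _ => ψ i) ?_ ?_ ?_
  · intro i hi
    refine Finset.mem_filter.mpr ⟨Finset.mem_univ _, ?_⟩
    rw [Equiv.permCongr_apply, ψ.symm_apply_apply, (Finset.mem_filter.mp hi).2]
  · intro i _ j _ h; exact ψ.injective h
  · intro j hj
    refine ⟨ψ.symm j, Finset.mem_filter.mpr ⟨Finset.mem_univ _, ?_⟩, by simp⟩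
    have := (Finset.mem_filter.mp hj).2
    rw [Equiv.permCongr_apply] at this
    rw [Equiv.eq_symm_apply, this]

/-- The number of `i` on which `τ a` and `τ b` differ by the same permutation as `τ' a`, `τ' b`. -/
def agreeCount {σ : Type*} [Fintype σ] [DecidableEq σ] {L : ℕ} (τ τ' : Fin L → Equiv.Perm σ)
    (a b : Fin L) : ℕ :=
  (Finset.univ.filter fun i => (τ b)⁻¹ (τ a i) = (τ' b)⁻¹ (τ' a i)).card

/-- Condition on `τ a = ρ`. The other `τ b` remain independent and uniform, and `agreeCount τ τ' a
b` is the number of fixed points of `(τ' a)⁻¹ * τ' b * (τ b)⁻¹ * ρ`, again a uniform permutation.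
The `L - 1` factors then separate. -/
theorem sum_prod_agreeCount_le {σ : Type*} [Fintype σ] [DecidableEq σ] {L : ℕ} {z : ℝ}
    (hz : 1 ≤ z) (τ' : Fin L → Equiv.Perm σ) (a : Fin L) :
    ∑ τ : Fin L → Equiv.Perm σ, ∏ b ∈ Finset.univ.erase a, z ^ agreeCount τ τ' a b ≤
      ((Fintype.card σ).factorial : ℝ) ^ L *
        Real.exp ((z - 1) * (1 + Real.log (Fintype.card σ))) ^ (L - 1) := by
  set M : ℝ := ((Fintype.card σ).factorial : ℝ) *
    Real.exp ((z - 1) * (1 + Real.log (Fintype.card σ))) with hM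
  -- The conditioning is encoded as an indicator at coordinate `a`, so that the sum over `τ` becomes
  -- a product over coordinates.
  let w : Equiv.Perm σ → Fin L → Equiv.Perm σ → ℝ := fun ρ b e =>
    if b = a then (if e = ρ then 1 else 0)
    else z ^ (Finset.univ.filter fun i => e⁻¹ (ρ i) = (τ' b)⁻¹ (τ' a i)).card
  have h1 : ∀ τ : Fin L → Equiv.Perm σ,
      ∏ b ∈ Finset.univ.erase a, z ^ agreeCount τ τ' a b = ∑ ρ, ∏ b, w ρ b (τ b) := by
    intro τ
    rw [Finset.sum_eq_single_of_mem (τ a) (Finset.mem_univ _)]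
    · rw [← Finset.mul_prod_erase _ _ (Finset.mem_univ a)]
      simp only [w, if_true, one_mul]
      refine Finset.prod_congr rfl fun b hb => ?_
      rw [if_neg (Finset.ne_of_mem_erase hb)]
      rfl
    · intro ρ _ hρ
      exact Finset.prod_eq_zero (Finset.mem_univ a) (by simp [w, hρ.symm])
  simp only [h1]
  rw [Finset.sum_comm]
  have h2 : ∀ ρ : Equiv.Perm σ, ∑ τ : Fin L → Equiv.Perm σ, ∏ b, w ρ b (τ b) ≤ M ^ (L - 1) := by
    intro ρ
    have := Finset.prod_univ_sum (fun _ : Fin L => (Finset.univ : Finset (Equiv.Perm σ))) (w ρ)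
    rw [Fintype.piFinset_univ] at this
    rw [← this, ← Finset.mul_prod_erase _ _ (Finset.mem_univ a)]
    have ha : ∑ e, w ρ a e = 1 := by simp [w]
    rw [ha, one_mul]
    have hcard : (Finset.univ.erase a).card = L - 1 := by
      rw [Finset.card_erase_of_mem (Finset.mem_univ a), Finset.card_univ, Fintype.card_fin]
    rw [← hcard, ← Finset.prod_const]
    refine Finset.prod_le_prod (fun b _ => Finset.sum_nonneg fun e _ => ?_) fun b hb => ?_
    · simp only [w]; split_ifs <;> positivity
    · have hb' := Finset.ne_of_mem_erase hb
      refine le_trans (le_of_eq ?_) (sum_pow_fixCount_le hz)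
      let T : Equiv.Perm (Equiv.Perm σ) :=
        (Equiv.inv _).trans ((Equiv.mulRight ρ).trans (Equiv.mulLeft ((τ' a)⁻¹ * τ' b)))
      rw [← Equiv.sum_comp T (fun e => z ^ fixCount e)]
      refine Finset.sum_congr rfl fun e _ => ?_
      simp only [w, if_neg hb', fixCount]
      congr 2
      ext i
      simp only [T, Finset.mem_filter, Finset.mem_univ, true_and, Equiv.trans_apply,
        Equiv.inv_apply, Equiv.coe_mulRight, Equiv.coe_mulLeft, Equiv.Perm.mul_apply]
      rw [Equiv.Perm.inv_eq_iff_eq (f := τ' a), Equiv.Perm.eq_inv_iff_eq]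
  refine (Finset.sum_le_sum fun ρ _ => h2 ρ).trans (le_of_eq ?_)
  have hL : L = (L - 1) + 1 := by have := a.pos; omega
  rw [Finset.sum_const, Finset.card_univ, Fintype.card_perm, nsmul_eq_mul, hM, mul_pow]
  conv_rhs => rw [hL]
  rw [pow_succ]
  simp only [Nat.add_sub_cancel]
  ring

/-- The counts for all pairs `(a, b)` are dependent, but for fixed `a` they are independent.
Jensen's inequality over `a` reduces to that case, at the price of the factor `L` in the exponent.
-/
theorem sum_sum_exp_agreeCount_le {σ : Type*} [Fintype σ] [DecidableEq σ] {L : ℕ} (hL : 0 < L)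
    {θ : ℝ} (hθ : 0 ≤ θ) :
    ∑ τ : Fin L → Equiv.Perm σ, ∑ τ' : Fin L → Equiv.Perm σ,
        Real.exp (θ * ∑ a, ∑ b ∈ Finset.univ.erase a, (agreeCount τ τ' a b : ℝ)) ≤
      (Fintype.card (Fin L → Equiv.Perm σ) : ℝ) ^ 2 *
        Real.exp ((Real.exp (θ * L) - 1) * (1 + Real.log (Fintype.card σ))) ^ (L - 1) := by
  set B := Real.exp ((Real.exp (θ * L) - 1) * (1 + Real.log (Fintype.card σ))) ^ (L - 1) with hB
  have hL' : (0 : ℝ) < L := by exact_mod_cast hL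
  have hz : 1 ≤ Real.exp (θ * L) := Real.one_le_exp (by positivity)
  have hcard : (Fintype.card (Fin L → Equiv.Perm σ) : ℝ) =
      ((Fintype.card σ).factorial : ℝ) ^ L := by
    simp [Fintype.card_perm]
  have hj : ∀ τ τ' : Fin L → Equiv.Perm σ,
      Real.exp (θ * ∑ a, ∑ b ∈ Finset.univ.erase a, (agreeCount τ τ' a b : ℝ)) ≤
        ∑ a, (L : ℝ)⁻¹ * ∏ b ∈ Finset.univ.erase a, Real.exp (θ * L) ^ agreeCount τ τ' a b := by
    intro τ τ'
    have := convexOn_exp.map_sum_le (t := Finset.univ) (w := fun _ : Fin L => (L : ℝ)⁻¹)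
      (p := fun a => θ * L * ∑ b ∈ Finset.univ.erase a, (agreeCount τ τ' a b : ℝ))
      (fun _ _ => by positivity) (by simp [hL'.ne']) (fun _ _ => Set.mem_univ _)
    simp only [smul_eq_mul] at this
    refine le_trans (le_of_eq ?_) (this.trans (le_of_eq ?_))
    · congr 1
      rw [Finset.mul_sum]
      exact Finset.sum_congr rfl fun a _ => by field_simp
    · refine Finset.sum_congr rfl fun a _ => ?_
      rw [Finset.mul_sum, Real.exp_sum]
      congr 1
      refine Finset.prod_congr rfl fun b _ => ?_
      rw [← Real.exp_nat_mul]
      ring_nf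
  calc _ ≤ ∑ τ : Fin L → Equiv.Perm σ, ∑ τ' : Fin L → Equiv.Perm σ,
        ∑ a, (L : ℝ)⁻¹ * ∏ b ∈ Finset.univ.erase a, Real.exp (θ * L) ^ agreeCount τ τ' a b :=
        Finset.sum_le_sum fun τ _ => Finset.sum_le_sum fun τ' _ => hj τ τ'
    _ = ∑ τ' : Fin L → Equiv.Perm σ, ∑ a, (L : ℝ)⁻¹ * ∑ τ : Fin L → Equiv.Perm σ,
        ∏ b ∈ Finset.univ.erase a, Real.exp (θ * L) ^ agreeCount τ τ' a b := by
        rw [Finset.sum_comm]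
        refine Finset.sum_congr rfl fun τ' _ => ?_
        rw [Finset.sum_comm]
        exact Finset.sum_congr rfl fun a _ => by rw [Finset.mul_sum]
    _ ≤ ∑ τ' : Fin L → Equiv.Perm σ, ∑ _a : Fin L,
        (L : ℝ)⁻¹ * (((Fintype.card σ).factorial : ℝ) ^ L * B) := by
        gcongr with τ' _ a _
        exact sum_prod_agreeCount_le hz τ' a
    _ = _ := by
        simp only [Finset.sum_const, Finset.card_univ, Fintype.card_fin, nsmul_eq_mul, hcard]
        field_simp

end FixedPoints

/-! ### A second moment comparison -/

section SecondMoment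

variable {ι : Type*} [Fintype ι] [DecidableEq ι]

/-- The likelihood ratio of a Bernoulli variable of mean `c * q` against one of mean `q`. -/
noncomputable def bernRatio (c q : ℝ) (b : Bool) : ℝ := if b then c else (1 - c * q) / (1 - q)

theorem bernRatio_pos {c q : ℝ} (hc : 1 < c) (hq : 0 < q) (hcq : c * q < 1) (b : Bool) :
    0 < bernRatio c q b := by
  have : q < 1 := by nlinarith
  unfold bernRatio
  split_ifs
  · linarith
  · exact div_pos (by linarith) (by linarith)

theorem bernWeight_mul_prod_bernRatio {c q : ℝ} (hc : 1 < c) (hq : 0 < q) (hcq : c * q < 1)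
    (T : Finset ι) (ω : ι → Bool) :
    bernWeight (fun _ => q) ω * ∏ x ∈ T, bernRatio c q (ω x) =
      bernWeight (fun x => if x ∈ T then c * q else q) ω := by
  have h1 : 1 - q ≠ 0 := by nlinarith
  rw [← bernWeight_mul_prod (fun _ => q) (fun x => if x ∈ T then c * q else q)
    (fun x b => if x ∈ T then bernRatio c q b else 1)]
  · congr 1
    simp [Finset.prod_ite_mem]
  · intro x
    split_ifs <;> simp [bernRatio, mul_comm]
  · intro x
    split_ifs
    · simp [bernRatio]; field_simp
    · simp

theorem bernExp_mul_prod_bernRatio {c q : ℝ} (hc : 1 < c) (hq : 0 < q) (hcq : c * q < 1)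
    (T : Finset ι) (f : (ι → Bool) → ℝ) :
    bernExp (fun _ => q) (fun ω => f ω * ∏ x ∈ T, bernRatio c q (ω x)) =
      bernExp (fun x => if x ∈ T then c * q else q) f := by
  simp only [bernExp, ← bernWeight_mul_prod_bernRatio hc hq hcq T]
  exact Finset.sum_congr rfl fun ω _ => by ring

/-- The inverse ratio has mean one under mean `c * q`, so only coordinates in both sets contribute.
Each gives the second moment `1 + q (c - 1)² / (c (1 - c q)) ≤ 1 + 2 c q`, the last step using `c *
q ≤ 1 / 2`. -/
theorem bernExp_prod_inv_mul_prod_inv_le {c q : ℝ} (hc : 1 < c) (hq : 0 < q)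
    (hcq : c * q ≤ 1 / 2) {T M M' : Finset ι} (hM : M ⊆ T) (hM' : M' ⊆ T) :
    bernExp (fun x => if x ∈ T then c * q else q)
        (fun ω => (∏ x ∈ M, (bernRatio c q (ω x))⁻¹) * ∏ x ∈ M', (bernRatio c q (ω x))⁻¹) ≤
      Real.exp (2 * (c * q) * (M ∩ M').card) := by
  have h1 : 0 < 1 - q := by nlinarith
  have h2 : 0 < 1 - c * q := by linarith
  have h := bernExp_prod (fun x => if x ∈ T then c * q else q)
    (fun x b => (if x ∈ M then (bernRatio c q b)⁻¹ else 1) *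
      (if x ∈ M' then (bernRatio c q b)⁻¹ else 1))
  simp only [Finset.prod_mul_distrib, Finset.prod_ite_mem, Finset.univ_inter] at h
  rw [h]
  have hv : q / c + (1 - q) ^ 2 / (1 - c * q) ≤ Real.exp (2 * (c * q)) := by
    refine le_trans ?_ (Real.add_one_le_exp _)
    have h2' : 1 - q * c ≠ 0 := by rw [mul_comm]; exact h2.ne'
    have hc0 : c ≠ 0 := by linarith
    have : q / c + (1 - q) ^ 2 / (1 - c * q) = 1 + q * (c - 1) ^ 2 / (c * (1 - c * q)) := by
      field_simp; ring
    rw [this, add_comm]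
    gcongr
    rw [div_le_iff₀ (by positivity)]
    have e1 : (c - 1) ^ 2 ≤ c ^ 2 := by nlinarith
    have e2 : q * (c - 1) ^ 2 ≤ q * c ^ 2 := mul_le_mul_of_nonneg_left e1 hq.le
    have e3 : 2 * (c * q) * (c * (1 / 2)) ≤ 2 * (c * q) * (c * (1 - c * q)) := by
      gcongr; linarith
    nlinarith
  have hx : ∀ x, (if x ∈ T then c * q else q) *
        ((if x ∈ M then (bernRatio c q true)⁻¹ else 1) *
          (if x ∈ M' then (bernRatio c q true)⁻¹ else 1)) +
      (1 - if x ∈ T then c * q else q) *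
        ((if x ∈ M then (bernRatio c q false)⁻¹ else 1) *
          (if x ∈ M' then (bernRatio c q false)⁻¹ else 1)) =
      if x ∈ M ∩ M' then q / c + (1 - q) ^ 2 / (1 - c * q) else 1 := by
    intro x
    by_cases m : x ∈ M <;> by_cases m' : x ∈ M'
    · simp only [hM m, m, m', Finset.mem_inter, bernRatio, if_true]
      simp; field_simp
    · simp only [hM m, m, m', Finset.mem_inter, bernRatio, if_true]
      simp; field_simp; ring
    · simp only [hM' m', m, m', Finset.mem_inter, bernRatio, if_true]
      simp; field_simp; ring
    · simp [m, m']
  simp only [hx]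
  rw [Finset.prod_ite_mem, Finset.univ_inter, Finset.prod_const,
    mul_comm (2 * (c * q)), Real.exp_nat_mul]
  exact pow_le_pow_left₀ (by positivity) hv _

theorem bernExp_prod_inv {c q : ℝ} (hc : 1 < c) (hq : 0 < q)
    (hcq : c * q < 1) {T M : Finset ι} (hM : M ⊆ T) :
    bernExp (fun x => if x ∈ T then c * q else q)
        (fun ω => ∏ x ∈ M, (bernRatio c q (ω x))⁻¹) = 1 := by
  have h1 : 0 < 1 - q := by nlinarith
  have h2 : 0 < 1 - c * q := by linarith
  have h := bernExp_prod (fun x => if x ∈ T then c * q else q)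
    (fun x b => if x ∈ M then (bernRatio c q b)⁻¹ else 1)
  simp only [Finset.prod_ite_mem, Finset.univ_inter] at h
  rw [h]
  refine Finset.prod_eq_one fun x _ => ?_
  by_cases m : x ∈ M
  · simp only [hM m, m, bernRatio, if_true]
    simp; field_simp; ring
  · simp [m]

/-- Removing random sets `M t` of planted coordinates is undetectable if two independent copies of
the random set have a small intersection. -/
theorem avg_bernExp_sdiff_le {κ : Type*} [Fintype κ] [Nonempty κ] {c q : ℝ} (hc : 1 < c)
    (hq : 0 < q) (hcq : c * q ≤ 1 / 2) (T : Finset ι) (M : κ → Finset ι) (hM : ∀ t, M t ⊆ T)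
    (f : (ι → Bool) → ℝ) (hf0 : ∀ ω, 0 ≤ f ω) (hf1 : ∀ ω, f ω ≤ 1) {Δ : ℝ}
    (hΔ : ∑ t, ∑ t', Real.exp (2 * (c * q) * (M t ∩ M t').card) ≤
      (Fintype.card κ : ℝ) ^ 2 * (1 + Δ)) :
    (Fintype.card κ : ℝ)⁻¹ * ∑ t, bernExp (fun _ => q)
        (fun ω => f ω * ∏ x ∈ T \ M t, bernRatio c q (ω x)) ≤
      bernExp (fun _ => q) (fun ω => f ω * ∏ x ∈ T, bernRatio c q (ω x)) + Real.sqrt Δ := by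
  have hcq' : c * q < 1 := by linarith
  have hκ : (0 : ℝ) < Fintype.card κ := by exact_mod_cast Fintype.card_pos
  set ρ : ι → ℝ := fun x => if x ∈ T then c * q else q with hρ
  have hρ0 : ∀ x, 0 ≤ ρ x := fun x => by simp only [hρ]; split_ifs <;> nlinarith
  have hρ1 : ∀ x, ρ x ≤ 1 := fun x => by simp only [hρ]; split_ifs <;> nlinarith
  set ℓ : κ → (ι → Bool) → ℝ := fun t ω => ∏ x ∈ M t, (bernRatio c q (ω x))⁻¹ with hℓ
  have h1 : ∀ t, bernExp (fun _ => q) (fun ω => f ω * ∏ x ∈ T \ M t, bernRatio c q (ω x)) =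
      bernExp ρ (fun ω => f ω * ℓ t ω) := by
    intro t
    rw [hρ, ← bernExp_mul_prod_bernRatio hc hq hcq']
    congr 1
    funext ω
    rw [← Finset.prod_sdiff (hM t), hℓ]
    simp only [Finset.prod_inv_distrib]
    have : ∏ x ∈ M t, bernRatio c q (ω x) ≠ 0 :=
      Finset.prod_ne_zero_iff.mpr fun x _ => (bernRatio_pos hc hq hcq' _).ne'
    field_simp
  -- `Λ` is the density of the averaged law with pairs removed, relative to the law planted on all
  -- of `T`; its variance is the chi-square distance.
  set Λ : (ι → Bool) → ℝ := fun ω => (Fintype.card κ : ℝ)⁻¹ * ∑ t, ℓ t ω with hΛ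
  have h2 : (Fintype.card κ : ℝ)⁻¹ * ∑ t, bernExp (fun _ => q)
      (fun ω => f ω * ∏ x ∈ T \ M t, bernRatio c q (ω x)) = bernExp ρ (fun ω => f ω * Λ ω) := by
    simp only [h1]
    rw [← bernExp_sum, ← bernExp_const_mul]
    congr 1
    funext ω
    simp only [hΛ, Finset.mul_sum]
    exact Finset.sum_congr rfl fun _ _ => by ring
  have hmean : bernExp ρ Λ = 1 := by
    simp only [hΛ]
    rw [bernExp_const_mul, bernExp_sum]
    simp only [hℓ, hρ, bernExp_prod_inv hc hq hcq' (hM _)]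
    simp [hκ.ne']
  have hsq : bernExp ρ (fun ω => (Λ ω - 1) ^ 2) ≤ Δ := by
    have e1 : ∀ ω, (Λ ω - 1) ^ 2 = (((Fintype.card κ : ℝ)⁻¹) ^ 2 * ∑ t, ∑ t', ℓ t ω * ℓ t' ω -
        2 * Λ ω) + 1 := by
      intro ω
      rw [← Finset.sum_mul_sum]
      simp only [hΛ]
      ring
    simp only [e1]
    rw [bernExp_add, bernExp_sub, bernExp_const_mul, bernExp_const_mul, hmean, bernExp_one,
      bernExp_sum]
    simp only [bernExp_sum]
    have e2 : ∑ t, ∑ t', bernExp ρ (fun ω => ℓ t ω * ℓ t' ω) ≤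
        (Fintype.card κ : ℝ) ^ 2 * (1 + Δ) :=
      (Finset.sum_le_sum fun t _ => Finset.sum_le_sum fun t' _ =>
        bernExp_prod_inv_mul_prod_inv_le hc hq hcq (hM t) (hM t')).trans hΔ
    have e3 := mul_le_mul_of_nonneg_left e2 (sq_nonneg ((Fintype.card κ : ℝ)⁻¹))
    have e4 : (Fintype.card κ : ℝ)⁻¹ ^ 2 * ((Fintype.card κ : ℝ) ^ 2 * (1 + Δ)) = 1 + Δ := by
      field_simp
    linarith
  rw [h2, bernExp_mul_prod_bernRatio hc hq hcq']
  -- Cauchy–Schwarz: a test with values in `[0, 1]` changes its mean by at most the root of the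
  -- chi-square distance.
  have hcs := bernExp_sq_le hρ0 hρ1 f (fun ω => Λ ω - 1)
  have hf2 : bernExp ρ (fun ω => f ω ^ 2) ≤ 1 := by
    rw [← bernExp_one ρ]
    exact bernExp_mono hρ0 hρ1 fun ω => by nlinarith [hf0 ω, hf1 ω]
  have hΔ0 : 0 ≤ bernExp ρ (fun ω => (Λ ω - 1) ^ 2) :=
    bernExp_nonneg hρ0 hρ1 fun ω => sq_nonneg _
  have h3 : bernExp ρ (fun ω => f ω * (Λ ω - 1)) ≤ Real.sqrt Δ := by
    apply Real.le_sqrt_of_sq_le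
    nlinarith
  have h4 : bernExp ρ (fun ω => f ω * (Λ ω - 1)) =
      bernExp ρ (fun ω => f ω * Λ ω) - bernExp ρ f := by
    rw [← bernExp_sub]; congr 1; funext ω; ring
  rw [h4] at h3
  linarith

end SecondMoment

/-! ### Blockwise randomized expansion of a configuration -/

theorem one_sub_sum_le_prod_one_sub {κ : Type*} [DecidableEq κ] (s : Finset κ) (x : κ → ℝ)
    (h0 : ∀ j, 0 ≤ x j) (h1 : ∀ j, x j ≤ 1) : 1 - ∑ j ∈ s, x j ≤ ∏ j ∈ s, (1 - x j) := by
  induction s using Finset.induction_on with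
  | empty => simp
  | insert j s hj ih =>
    rw [Finset.sum_insert hj, Finset.prod_insert hj]
    have hp : ∏ j ∈ s, (1 - x j) ≤ 1 :=
      Finset.prod_le_one (fun i _ => by linarith [h1 i]) fun i _ => by linarith [h0 i]
    nlinarith [h0 j]

section Blocks

variable {ι β : Type*} [Fintype ι] [DecidableEq ι] [Fintype β] [DecidableEq β]

/-- The likelihood ratio of the block over `B`. -/
noncomputable def blockRatio (b : ι → β) (c q : ℝ) (B : β) (ω : ι → Bool) : ℝ :=
  ∏ x with b x = B, bernRatio c q (ω x)

/-- The number of open coordinates in the block over `B`. -/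
def blockCount (b : ι → β) (B : β) (ω : ι → Bool) : ℕ :=
  (Finset.univ.filter fun x => b x = B ∧ ω x = true).card

/-- The likelihood ratio of a block, restricted to at most `W` open coordinates. -/
noncomputable def truncRatio (b : ι → β) (c q : ℝ) (W : ℕ) (B : β) (ω : ι → Bool) : ℝ :=
  if blockCount b B ω ≤ W then blockRatio b c q B ω else 0

/-- The mass lost by truncating the likelihood ratio of a block. -/
noncomputable def blockDefect (b : ι → β) (c q : ℝ) (W : ℕ) (B : β) : ℝ :=
  1 - bernExp (fun _ : ι => q) (truncRatio b c q W B)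

/-- The density of the block over `B` if it comes from an edge; blocks outside `off` are not
changed. -/
noncomputable def openDensity (b : ι → β) (off : Finset β) (c q : ℝ) (W : ℕ) (B : β)
    (ω : ι → Bool) : ℝ :=
  if B ∈ off then truncRatio b c q W B ω + blockDefect b c q W B else 1

/-- The density of the block over `B` if it comes from a non-edge. -/
noncomputable def closedDensity (b : ι → β) (off : Finset β) (c q γ : ℝ) (W : ℕ) (B : β)
    (ω : ι → Bool) : ℝ :=
  (1 - γ * openDensity b off c q W B ω) / (1 - γ)

theorem blockCount_congr (b : ι → β) (B : β) {ω ω' : ι → Bool}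
    (h : ∀ x, b x = B → ω x = ω' x) : blockCount b B ω = blockCount b B ω' := by
  unfold blockCount
  congr 1
  ext x
  simp only [Finset.mem_filter, Finset.mem_univ, true_and]
  exact and_congr_right fun hx => by rw [h x hx]

theorem dependsOnly_blockRatio (b : ι → β) (c q : ℝ) (B : β) :
    DependsOnly (fun x => b x = B) (blockRatio b c q B) := fun ω ω' h =>
  Finset.prod_congr rfl fun x hx => by rw [h x (Finset.mem_filter.mp hx).2]

theorem dependsOnly_truncRatio (b : ι → β) (c q : ℝ) (W : ℕ) (B : β) :
    DependsOnly (fun x => b x = B) (truncRatio b c q W B) := fun ω ω' h => by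
  simp only [truncRatio, blockCount_congr b B h, dependsOnly_blockRatio b c q B ω ω' h]

theorem dependsOnly_openDensity (b : ι → β) (off : Finset β) (c q : ℝ) (W : ℕ) (B : β) :
    DependsOnly (fun x => b x = B) (openDensity b off c q W B) := fun ω ω' h => by
  simp only [openDensity, dependsOnly_truncRatio b c q W B ω ω' h]

theorem dependsOnly_closedDensity (b : ι → β) (off : Finset β) (c q γ : ℝ) (W : ℕ) (B : β) :
    DependsOnly (fun x => b x = B) (closedDensity b off c q γ W B) := fun ω ω' h => by
  simp only [closedDensity, dependsOnly_openDensity b off c q W B ω ω' h]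

/-! ### Mass, tails and positivity of the block densities -/

section Facts

variable (b : ι → β) (off : Finset β) {c q γ : ℝ} {W : ℕ}

theorem bernExp_blockRatio (hc : 1 < c) (hq : 0 < q) (hcq : c * q < 1) (B : β) :
    bernExp (fun _ => q) (blockRatio b c q B) = 1 := by
  have := bernExp_mul_prod_bernRatio hc hq hcq (Finset.univ.filter fun x => b x = B) (fun _ => 1)
  rw [bernExp_one] at this
  simp only [one_mul] at this
  exact this

theorem blockRatio_pos (hc : 1 < c) (hq : 0 < q) (hcq : c * q < 1) (B : β) (ω : ι → Bool) :
    0 < blockRatio b c q B ω :=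
  Finset.prod_pos fun _ _ => bernRatio_pos hc hq hcq _

theorem blockRatio_le (hc : 1 < c) (hq : 0 < q) (hcq : c * q < 1) (B : β) (ω : ι → Bool) :
    blockRatio b c q B ω ≤ c ^ blockCount b B ω := by
  have h1 : blockRatio b c q B ω ≤ ∏ x with b x = B, (if ω x = true then c else 1) := by
    refine Finset.prod_le_prod (fun x _ => (bernRatio_pos hc hq hcq _).le) fun x _ => ?_
    unfold bernRatio
    split_ifs
    · exact le_rfl
    · rw [div_le_one (by nlinarith)]
      nlinarith
  refine h1.trans (le_of_eq ?_)
  rw [Finset.prod_ite, Finset.prod_const, Finset.prod_const_one, mul_one, Finset.filter_filter]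
  rfl

theorem truncRatio_nonneg (hc : 1 < c) (hq : 0 < q) (hcq : c * q < 1) (B : β) (ω : ι → Bool) :
    0 ≤ truncRatio b c q W B ω := by
  unfold truncRatio
  split_ifs
  · exact (blockRatio_pos b hc hq hcq B ω).le
  · exact le_rfl

theorem truncRatio_le_blockRatio (hc : 1 < c) (hq : 0 < q) (hcq : c * q < 1) (B : β)
    (ω : ι → Bool) : truncRatio b c q W B ω ≤ blockRatio b c q B ω := by
  unfold truncRatio
  split_ifs
  · exact le_rfl
  · exact (blockRatio_pos b hc hq hcq B ω).le

theorem truncRatio_le_pow (hc : 1 < c) (hq : 0 < q) (hcq : c * q < 1) (B : β) (ω : ι → Bool) :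
    truncRatio b c q W B ω ≤ c ^ W := by
  unfold truncRatio
  split_ifs with h
  · exact (blockRatio_le b hc hq hcq B ω).trans (pow_le_pow_right₀ hc.le h)
  · positivity

theorem lt_one_of_mul_lt_one (hc : 1 < c) (hq : 0 < q) (hcq : c * q < 1) : q < 1 := by nlinarith

theorem blockDefect_nonneg (hc : 1 < c) (hq : 0 < q) (hcq : c * q < 1) (B : β) :
    0 ≤ blockDefect b c q W B := by
  have := bernExp_mono (fun _ : ι => hq.le) (fun _ => (lt_one_of_mul_lt_one hc hq hcq).le)
    (truncRatio_le_blockRatio b (W := W) hc hq hcq B)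
  rw [bernExp_blockRatio b hc hq hcq B] at this
  unfold blockDefect
  linarith

theorem blockDefect_le_one (hc : 1 < c) (hq : 0 < q) (hcq : c * q < 1) (B : β) :
    blockDefect b c q W B ≤ 1 := by
  have := bernExp_nonneg (fun _ : ι => hq.le) (fun _ => (lt_one_of_mul_lt_one hc hq hcq).le)
    (truncRatio_nonneg b (W := W) hc hq hcq B)
  unfold blockDefect
  linarith

/-- No mass is lost if the block has at most `W` coordinates. -/
theorem blockDefect_eq_zero (hc : 1 < c) (hq : 0 < q) (hcq : c * q < 1) (B : β)
    (hB : (Finset.univ.filter fun x => b x = B).card ≤ W) : blockDefect b c q W B = 0 := by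
  have : truncRatio b c q W B = blockRatio b c q B := by
    funext ω
    refine if_pos (le_trans (Finset.card_le_card fun x hx => ?_) hB)
    exact Finset.mem_filter.mpr ⟨Finset.mem_univ _, (Finset.mem_filter.mp hx).2.1⟩
  rw [blockDefect, this, bernExp_blockRatio b hc hq hcq, sub_self]

/-- The lost mass is small if the expected number of open coordinates is small. -/
theorem blockDefect_le (hc : 1 < c) (hq : 0 < q) (hcq : c * q < 1) (B : β) {ν : ℝ}
    (hν0 : 0 < ν) (hν1 : ν ≤ 1)
    (hB : c * q * (Finset.univ.filter fun x => b x = B).card ≤ ν) :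
    blockDefect b c q W B ≤ Real.exp 1 * ν ^ (W + 1) := by
  have hq1 := lt_one_of_mul_lt_one hc hq hcq
  set T := Finset.univ.filter fun x => b x = B with hT
  have hz : 1 ≤ ν⁻¹ := (one_le_inv₀ hν0).mpr hν1
  have h1 : blockDefect b c q W B = bernExp (fun _ => q)
      (fun ω => blockRatio b c q B ω - truncRatio b c q W B ω) := by
    rw [bernExp_sub, bernExp_blockRatio b hc hq hcq, blockDefect]
  -- Exponential Markov inequality with base `ν⁻¹`: where the truncation bites, the count is at
  -- least `W + 1`, so `ν ^ (W + 1) * ν⁻¹ ^ count ≥ 1`.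
  have h2 : ∀ ω, blockRatio b c q B ω - truncRatio b c q W B ω ≤
      ν ^ (W + 1) * ((∏ x ∈ T, if ω x = true then ν⁻¹ else 1) * blockRatio b c q B ω) := by
    intro ω
    have hR := blockRatio_pos b hc hq hcq B ω
    have hprod : (∏ x ∈ T, if ω x = true then ν⁻¹ else 1) = ν⁻¹ ^ blockCount b B ω := by
      rw [Finset.prod_ite, Finset.prod_const, Finset.prod_const_one, mul_one, hT,
        Finset.filter_filter]
      rfl
    rw [hprod]
    unfold truncRatio
    split_ifs with h
    · rw [sub_self]; positivity
    · rw [sub_zero, ← mul_assoc]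
      have : (1 : ℝ) ≤ ν ^ (W + 1) * ν⁻¹ ^ blockCount b B ω := by
        calc (1 : ℝ) = ν ^ (W + 1) * ν⁻¹ ^ (W + 1) := by
              rw [← mul_pow, mul_inv_cancel₀ hν0.ne', one_pow]
          _ ≤ _ := by
              exact mul_le_mul_of_nonneg_left (pow_le_pow_right₀ hz (by omega)) (by positivity)
      nlinarith
  rw [h1]
  refine (bernExp_mono (fun _ => hq.le) (fun _ => hq1.le) h2).trans ?_
  rw [bernExp_const_mul, mul_comm (Real.exp 1)]
  refine mul_le_mul_of_nonneg_left ?_ (by positivity)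
  have h3 := bernExp_mul_prod_bernRatio hc hq hcq T
    (fun ω => ∏ x ∈ T, if ω x = true then ν⁻¹ else 1)
  have h4 := bernExp_prod (fun x => if x ∈ T then c * q else q)
    (fun x d => if x ∈ T then (if d = true then ν⁻¹ else 1) else 1)
  simp only [Finset.prod_ite_mem, Finset.univ_inter] at h4
  change bernExp _ (fun ω => (∏ x ∈ T, if ω x = true then ν⁻¹ else 1) *
    ∏ x ∈ T, bernRatio c q (ω x)) ≤ _
  rw [h3, h4]
  -- Each coordinate contributes at most `1 + c q / ν`. Since `c * q * T.card ≤ ν`, the whole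
  -- product is at most `exp 1`.
  have h5 : ∀ x, (if x ∈ T then c * q else q) *
      (if x ∈ T then (if true = true then ν⁻¹ else 1) else 1) +
      (1 - if x ∈ T then c * q else q) *
      (if x ∈ T then (if false = true then ν⁻¹ else 1) else 1) ≤
      if x ∈ T then Real.exp (c * q * ν⁻¹) else 1 := by
    intro x
    by_cases hx : x ∈ T
    · simp only [hx, if_true, Bool.false_eq_true, if_false, mul_one]
      have := Real.add_one_le_exp (c * q * ν⁻¹)
      nlinarith
    · simp [hx]
  refine (Finset.prod_le_prod (fun x _ => ?_) fun x _ => h5 x).trans ?_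
  · by_cases hx : x ∈ T
    · simp only [hx, if_true, Bool.false_eq_true, if_false, mul_one]
      have : 0 < ν⁻¹ := by positivity
      have : 0 < c * q := by positivity
      have : 0 < c * q * ν⁻¹ := by positivity
      linarith
    · simp [hx]
  · rw [Finset.prod_ite_mem, Finset.univ_inter, Finset.prod_const, ← Real.exp_nat_mul]
    apply Real.exp_le_exp.mpr
    calc (T.card : ℝ) * (c * q * ν⁻¹) = c * q * T.card * ν⁻¹ := by ring
      _ ≤ ν * ν⁻¹ := by gcongr
      _ = 1 := mul_inv_cancel₀ hν0.ne'

theorem openDensity_nonneg (hc : 1 < c) (hq : 0 < q) (hcq : c * q < 1) (B : β) (ω : ι → Bool) :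
    0 ≤ openDensity b off c q W B ω := by
  unfold openDensity
  split_ifs
  · exact add_nonneg (truncRatio_nonneg b hc hq hcq B ω) (blockDefect_nonneg b hc hq hcq B)
  · exact zero_le_one

theorem openDensity_le (hc : 1 < c) (hq : 0 < q) (hcq : c * q < 1) (B : β) (ω : ι → Bool) :
    openDensity b off c q W B ω ≤ c ^ W + 1 := by
  unfold openDensity
  split_ifs
  · exact add_le_add (truncRatio_le_pow b hc hq hcq B ω) (blockDefect_le_one b hc hq hcq B)
  · have : 0 < c ^ W := by positivity
    linarith

theorem bernExp_openDensity (B : β) :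
    bernExp (fun _ => q) (openDensity b off c q W B) = 1 := by
  unfold openDensity
  split_ifs
  · rw [bernExp_add, bernExp_const, blockDefect]; ring
  · exact bernExp_one _

/-- This is the purpose of the truncation: `openDensity` is at most `c ^ W + 1`, so a constant `γ`
keeps the non-edge density nonnegative. -/
theorem closedDensity_nonneg (hc : 1 < c) (hq : 0 < q) (hcq : c * q < 1) (hγ0 : 0 ≤ γ)
    (hγ1 : γ < 1) (hγ : γ * (c ^ W + 1) ≤ 1) (B : β) (ω : ι → Bool) :
    0 ≤ closedDensity b off c q γ W B ω := by
  refine div_nonneg ?_ (by linarith)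
  have := mul_le_mul_of_nonneg_left (openDensity_le b off (W := W) hc hq hcq B ω) hγ0
  linarith

theorem bernExp_closedDensity (hγ1 : γ < 1) (B : β) :
    bernExp (fun _ => q) (closedDensity b off c q γ W B) = 1 := by
  have : closedDensity b off c q γ W B =
      fun ω => (1 - γ)⁻¹ * (1 - γ * openDensity b off c q W B ω) := by
    funext ω; rw [closedDensity, div_eq_inv_mul]
  rw [this, bernExp_const_mul, bernExp_sub, bernExp_const_mul, bernExp_openDensity, bernExp_one]
  have : 1 - γ ≠ 0 := by linarith
  field_simp

end Facts

/-- The law of the pair of configurations used for edges and for non-edges. -/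
noncomputable def seedWeight (b : ι → β) (off : Finset β) (c q γ : ℝ) (W : ℕ)
    (H₁ H₀ : ι → Bool) : ℝ :=
  bernWeight (fun _ => q) H₁ * bernWeight (fun _ => q) H₀ *
    ((∏ B, openDensity b off c q W B H₁) * ∏ B, closedDensity b off c q γ W B H₀)

/-! ### The law of the expanded configuration -/

section Law

variable (b : ι → β) (off : Finset β) {c q γ : ℝ} {W : ℕ}

theorem seedWeight_nonneg (hc : 1 < c) (hq : 0 < q) (hcq : c * q < 1) (hγ0 : 0 ≤ γ)
    (hγ1 : γ < 1) (hγ : γ * (c ^ W + 1) ≤ 1) (H₁ H₀ : ι → Bool) :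
    0 ≤ seedWeight b off c q γ W H₁ H₀ := by
  have hq1 := lt_one_of_mul_lt_one hc hq hcq
  have h := fun ω : ι → Bool => bernWeight_nonneg (fun _ => hq.le) (fun _ => hq1.le) ω
  exact mul_nonneg (mul_nonneg (h H₁) (h H₀))
    (mul_nonneg (Finset.prod_nonneg fun B _ => openDensity_nonneg b off hc hq hcq B _)
      (Finset.prod_nonneg fun B _ => closedDensity_nonneg b off hc hq hcq hγ0 hγ1 hγ B _))

/-- The law of the expansion of a fixed coarse configuration. -/
theorem sum_seedWeight_splice (hγ1 : γ < 1) (G : β → Bool) (f : (ι → Bool) → ℝ) :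
    ∑ H₁, ∑ H₀, seedWeight b off c q γ W H₁ H₀ * f (splice (fun x => G (b x)) H₁ H₀) =
      bernExp (fun _ => q) (fun H => f H * ∏ B, if G B then openDensity b off c q W B H
        else closedDensity b off c q γ W B H) := by
  set D : ι → Bool := fun x => G (b x) with hD
  -- After the exchange the glued configuration is a single variable `H`. The second variable `H'`
  -- carries the unused halves of all blocks and integrates to one (`hone`).
  have key := sum_sum_bernWeight_splice D (fun _ => q) (fun _ => q) (fun H₁ H₀ =>
    ((∏ B, openDensity b off c q W B H₁) * ∏ B, closedDensity b off c q γ W B H₀) *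
      f (splice D H₁ H₀))
  have hs : splice D (fun _ => q) (fun _ => q) = fun _ => q := by funext x; simp [splice]
  simp only [hs, splice_splice_left] at key
  simp only [seedWeight, mul_assoc] at key ⊢
  rw [key, bernExp]
  refine Finset.sum_congr rfl fun H _ => ?_
  have hopen : ∀ H' : ι → Bool, ∏ B, openDensity b off c q W B (splice D H H') =
      ∏ B, if G B then openDensity b off c q W B H else openDensity b off c q W B H' := by
    intro H'
    refine Finset.prod_congr rfl fun B _ => ?_
    split_ifs with h
    · exact dependsOnly_openDensity b off c q W B _ _ fun x hx => by simp [splice, hD, hx, h]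
    · exact dependsOnly_openDensity b off c q W B _ _ fun x hx => by simp [splice, hD, hx, h]
  have hclosed : ∀ H' : ι → Bool, ∏ B, closedDensity b off c q γ W B (splice D H' H) =
      ∏ B, if G B then closedDensity b off c q γ W B H' else closedDensity b off c q γ W B H := by
    intro H'
    refine Finset.prod_congr rfl fun B _ => ?_
    split_ifs with h
    · exact dependsOnly_closedDensity b off c q γ W B _ _ fun x hx => by simp [splice, hD, hx, h]
    · exact dependsOnly_closedDensity b off c q γ W B _ _ fun x hx => by simp [splice, hD, hx, h]
  have hone : bernExp (fun _ => q) (fun H' : ι → Bool => ∏ B, if G B then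
      closedDensity b off c q γ W B H' else openDensity b off c q W B H') = 1 := by
    rw [bernExp_prod_blocks (fun _ => q) b Finset.univ (fun B H' => if G B then
      closedDensity b off c q γ W B H' else openDensity b off c q W B H')]
    · refine Finset.prod_eq_one fun B _ => ?_
      cases G B
      · exact bernExp_openDensity b off B
      · exact bernExp_closedDensity b off hγ1 B
    · intro B _
      cases G B
      · exact dependsOnly_openDensity b off c q W B
      · exact dependsOnly_closedDensity b off c q γ W B
  have hre : ∀ H' : ι → Bool, bernWeight (fun _ => q) H * (bernWeight (fun _ => q) H' *
      ((∏ B, openDensity b off c q W B (splice D H H')) *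
        ((∏ B, closedDensity b off c q γ W B (splice D H' H)) * f H))) =
      (bernWeight (fun _ => q) H * (f H * ∏ B, if G B then openDensity b off c q W B H
        else closedDensity b off c q γ W B H)) *
      (bernWeight (fun _ => q) H' * ∏ B, if G B then closedDensity b off c q γ W B H'
        else openDensity b off c q W B H') := by
    intro H'
    rw [hopen, hclosed]
    have : (∏ B, if G B then openDensity b off c q W B H else openDensity b off c q W B H') *
        (∏ B, if G B then closedDensity b off c q γ W B H' else closedDensity b off c q γ W B H) =
        (∏ B, if G B then openDensity b off c q W B H else closedDensity b off c q γ W B H) *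
        ∏ B, if G B then closedDensity b off c q γ W B H' else openDensity b off c q W B H' := by
      rw [← Finset.prod_mul_distrib, ← Finset.prod_mul_distrib]
      refine Finset.prod_congr rfl fun B _ => ?_
      split_ifs <;> ring
    linear_combination (bernWeight (fun _ => q) H * bernWeight (fun _ => q) H' * f H) * this
  simp only [hre]
  rw [← Finset.mul_sum]
  rw [bernExp] at hone
  rw [hone, mul_one]

theorem sum_seedWeight (hγ1 : γ < 1) :
    ∑ H₁, ∑ H₀, seedWeight b off c q γ W H₁ H₀ = 1 := by
  have h := sum_seedWeight_splice b off (c := c) (q := q) (W := W) hγ1 (fun _ => true)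
    (fun _ => 1)
  simp only [mul_one, one_mul, if_true] at h
  rw [h, bernExp_prod_blocks (fun _ => q) b Finset.univ (openDensity b off c q W)
    (fun B _ => dependsOnly_openDensity b off c q W B)]
  exact Finset.prod_eq_one fun B _ => bernExp_openDensity b off B

/-- The coarse configuration in which the blocks of `C` are opened and those outside `off` are
closed. -/
def plantBlocks (off C : Finset β) (ω : β → Bool) (B : β) : Bool :=
  decide (B ∈ off) && (ω B || decide (B ∈ C))

/-- The law of the expansion of a coarse Bernoulli configuration in which the blocks of `C` have
been opened. -/
theorem sum_seedWeight_bernExp (hγ1 : γ < 1) {C : Finset β} (hC : C ⊆ off)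
    (f : (ι → Bool) → ℝ) :
    ∑ H₁, ∑ H₀, seedWeight b off c q γ W H₁ H₀ * bernExp (fun _ => γ)
        (fun ω => f (splice (fun x => plantBlocks off C ω (b x)) H₁ H₀)) =
      bernExp (fun _ => q) (fun H => f H * ∏ B ∈ C, openDensity b off c q W B H) := by
  have h1 : ∑ H₁, ∑ H₀, seedWeight b off c q γ W H₁ H₀ * bernExp (fun _ => γ)
        (fun ω => f (splice (fun x => plantBlocks off C ω (b x)) H₁ H₀)) =
      bernExp (fun _ => γ) (fun ω => ∑ H₁, ∑ H₀, seedWeight b off c q γ W H₁ H₀ *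
        f (splice (fun x => plantBlocks off C ω (b x)) H₁ H₀)) := by
    rw [bernExp_sum]
    refine Finset.sum_congr rfl fun H₁ _ => ?_
    rw [bernExp_sum]
    exact Finset.sum_congr rfl fun H₀ _ => by rw [bernExp_const_mul]
  rw [h1]
  simp only [sum_seedWeight_splice b off hγ1]
  simp only [bernExp, Finset.mul_sum]
  rw [Finset.sum_comm]
  refine Finset.sum_congr rfl fun H _ => ?_
  -- A block of `off` not in `C` is open with probability `γ`, and `γ * open + (1 - γ) * closed =
  -- 1`. Blocks outside `off` have density one, so only those of `C` survive.
  have h2 : bernExp (fun _ => γ) (fun ω => ∏ B, if plantBlocks off C ω B then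
      openDensity b off c q W B H else closedDensity b off c q γ W B H) =
      ∏ B ∈ C, openDensity b off c q W B H := by
    have := bernExp_prod (fun _ : β => γ) (fun B d => if decide (B ∈ off) && (d || decide (B ∈ C))
      then openDensity b off c q W B H else closedDensity b off c q γ W B H)
    refine this.trans ?_
    rw [← Finset.prod_subset (Finset.subset_univ C)]
    · refine Finset.prod_congr rfl fun B hB => ?_
      simp only [hC hB, hB, decide_true, Bool.or_true, Bool.and_true, if_true]
      ring
    · intro B _ hB
      have hne : 1 - γ ≠ 0 := by linarith
      by_cases ho : B ∈ off
      · simp only [ho, hB, decide_true, decide_false, Bool.or_false, Bool.and_true, Bool.true_and,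
          if_true, Bool.false_eq_true, if_false, closedDensity]
        field_simp
        ring
      · simp only [ho, decide_false, Bool.false_and, Bool.false_eq_true, if_false, closedDensity,
          openDensity]
        field_simp
        ring
  rw [← h2, bernExp, Finset.mul_sum, Finset.mul_sum]
  exact Finset.sum_congr rfl fun ω _ => by ring

/-- Replacing truncated likelihood ratios by likelihood ratios. -/
theorem bernExp_mul_prod_openDensity_le (hc : 1 < c) (hq : 0 < q) (hcq : c * q < 1)
    {C : Finset β} (hC : C ⊆ off) (f : (ι → Bool) → ℝ) (hf0 : ∀ ω, 0 ≤ f ω) (hf1 : ∀ ω, f ω ≤ 1) :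
    bernExp (fun _ => q) (fun H => f H * ∏ B ∈ C, openDensity b off c q W B H) ≤
      bernExp (fun _ => q) (fun H => f H * ∏ x with b x ∈ C, bernRatio c q (H x)) +
        ∑ B ∈ C, blockDefect b c q W B := by
  have hq1 := lt_one_of_mul_lt_one hc hq hcq
  have hprod : ∀ H : ι → Bool, ∏ x with b x ∈ C, bernRatio c q (H x) =
      ∏ B ∈ C, blockRatio b c q B H := by
    intro H
    rw [← Finset.prod_fiberwise_of_maps_to (t := C) (g := b)
      (fun x hx => (Finset.mem_filter.mp hx).2)]
    refine Finset.prod_congr rfl fun B hB => ?_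
    unfold blockRatio
    congr 1
    ext x
    simp only [Finset.mem_filter, Finset.mem_univ, true_and]
    exact ⟨fun h => h.2, fun h => ⟨h ▸ hB, h⟩⟩
  -- The truncated product lies below both the product of open densities and that of likelihood
  -- ratios. As `0 ≤ f ≤ 1`, the error is at most the mass of the first minus the truncated mass.
  have hpt : ∀ H : ι → Bool, f H * ∏ B ∈ C, openDensity b off c q W B H ≤
      f H * ∏ x with b x ∈ C, bernRatio c q (H x) +
        (∏ B ∈ C, openDensity b off c q W B H - ∏ B ∈ C, truncRatio b c q W B H) := by
    intro H
    rw [hprod]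
    have e1 : ∏ B ∈ C, truncRatio b c q W B H ≤ ∏ B ∈ C, blockRatio b c q B H :=
      Finset.prod_le_prod (fun B _ => truncRatio_nonneg b hc hq hcq B H)
        fun B _ => truncRatio_le_blockRatio b hc hq hcq B H
    have e2 : ∏ B ∈ C, truncRatio b c q W B H ≤ ∏ B ∈ C, openDensity b off c q W B H :=
      Finset.prod_le_prod (fun B _ => truncRatio_nonneg b hc hq hcq B H) fun B hB => by
        rw [openDensity, if_pos (hC hB)]
        linarith [blockDefect_nonneg b (W := W) hc hq hcq B]
    nlinarith [hf0 H, hf1 H]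
  refine (bernExp_mono (fun _ => hq.le) (fun _ => hq1.le) hpt).trans ?_
  rw [bernExp_add, bernExp_sub]
  have e3 : bernExp (fun _ => q) (fun H : ι → Bool => ∏ B ∈ C, openDensity b off c q W B H) = 1 := by
    rw [bernExp_prod_blocks (fun _ => q) b C (openDensity b off c q W)
      (fun B _ => dependsOnly_openDensity b off c q W B)]
    exact Finset.prod_eq_one fun B _ => bernExp_openDensity b off B
  have e4 : bernExp (fun _ => q) (fun H : ι → Bool => ∏ B ∈ C, truncRatio b c q W B H) =
      ∏ B ∈ C, (1 - blockDefect b c q W B) := by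
    rw [bernExp_prod_blocks (fun _ => q) b C (truncRatio b c q W)
      (fun B _ => dependsOnly_truncRatio b c q W B)]
    exact Finset.prod_congr rfl fun B _ => by rw [blockDefect]; ring
  have e5 := one_sub_sum_le_prod_one_sub C (fun B => blockDefect b c q W B)
    (fun B => blockDefect_nonneg b hc hq hcq B) (fun B => blockDefect_le_one b hc hq hcq B)
  linarith

end Law

end Blocks

/-! ### Reducing planted clique to planted dense subgraph -/

section Reduction

theorem bernExp_congr_of_dependsOnly {ι : Type*} [Fintype ι] [DecidableEq ι] (D : ι → Prop)
    {ρ ρ' : ι → ℝ} (hρ : ∀ x, D x → ρ x = ρ' x) {f : (ι → Bool) → ℝ} (hf : DependsOnly D f) :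
    bernExp ρ f = bernExp ρ' f := by
  classical
  have hs : splice (fun x => decide (D x)) ρ ρ' = ρ' := by
    funext x
    by_cases h : D x
    · simp [splice, h, hρ x h]
    · simp [splice, h]
  have hfs : ∀ ω ω', f (splice (fun x => decide (D x)) ω ω') = f ω := fun ω ω' =>
    hf _ _ fun x hx => by simp [splice, hx]
  have key := sum_sum_bernWeight_glue (fun x => decide (D x)) ρ ρ' f
  rw [hs] at key
  rw [← key, bernExp]
  refine Finset.sum_congr rfl fun ω _ => ?_
  have hone := bernExp_one ρ'
  simp only [bernExp, mul_one] at hone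
  simp only [hfs]
  rw [← Finset.sum_mul, ← Finset.mul_sum, hone, mul_one]

/-- Derandomization of the reduction: some fixed choice does no worse than average. -/
theorem exists_le_of_weighted_sum_le {κ : Type*} [Fintype κ] (w X : κ → ℝ) {R : ℝ}
    (hw : ∀ t, 0 ≤ w t) (hw1 : ∑ t, w t = 1) (h : ∑ t, w t * X t ≤ R) : ∃ t, X t ≤ R := by
  by_contra! hcon
  have h1 : ∀ t, w t * R ≤ w t * X t := fun t => mul_le_mul_of_nonneg_left (hcon t).le (hw t)
  have h2 : ∑ t, w t * R = R := by rw [← Finset.sum_mul, hw1, one_mul]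
  obtain ⟨t, -, ht⟩ : ∃ t ∈ Finset.univ, 0 < w t := by
    by_contra! h0
    have := Finset.sum_nonpos h0
    linarith
  have h3 : ∑ t, w t * R < ∑ t, w t * X t :=
    Finset.sum_lt_sum (fun t _ => h1 t) ⟨t, Finset.mem_univ t, mul_lt_mul_of_pos_left (hcon t) ht⟩
  linarith

variable {m L N : ℕ}

/-- The first coordinate of a labelling of the vertices by pairs. -/
def vertexMap (e : Fin N ≃ Fin m × Fin L) (v : Fin N) : Fin m := (e v).1

open Classical in
/-- The non-diagonal pairs. -/
noncomputable def offDiagPairs (m : ℕ) : Finset (Sym2 (Fin m)) :=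
  Finset.univ.filter fun B => ¬ B.IsDiag

open Classical in
/-- The non-diagonal pairs inside `S`. -/
noncomputable def insidePairs {m : ℕ} (S : Finset (Fin m)) : Finset (Sym2 (Fin m)) :=
  Finset.univ.filter fun B => ¬ B.IsDiag ∧ ∀ i ∈ B, i ∈ S

theorem mk_mem_insidePairs (S : Finset (Fin m)) (i j : Fin m) :
    s(i, j) ∈ insidePairs S ↔ i ≠ j ∧ i ∈ S ∧ j ∈ S := by
  simp [insidePairs]

theorem insidePairs_subset (S : Finset (Fin m)) : insidePairs S ⊆ offDiagPairs m := fun _ hB =>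
  Finset.mem_filter.mpr ⟨Finset.mem_univ _, (Finset.mem_filter.mp hB).2.1⟩

theorem card_insidePairs_le (S : Finset (Fin m)) : (insidePairs S).card ≤ S.card ^ 2 := by
  classical
  have : insidePairs S ⊆ (S ×ˢ S).image fun p => s(p.1, p.2) := by
    intro B hB
    have h := (Finset.mem_filter.mp hB).2.2
    induction B using Sym2.ind with
    | _ i j =>
      exact Finset.mem_image.mpr ⟨(i, j), Finset.mem_product.mpr ⟨h i (by simp), h j (by simp)⟩, rfl⟩
  refine (Finset.card_le_card this).trans (Finset.card_image_le.trans ?_)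
  rw [Finset.card_product, sq]

-- Two copies of one base vertex are never adjacent in the base graph, so such pairs read `H₀`; this
-- matches the closed blocks outside `offDiagPairs`.
open Classical in
theorem pullGraph_configGraph_sup (e : Fin N ≃ Fin m × Fin L) (H₁ H₀ : Sym2 (Fin N) → Bool)
    (ω : Sym2 (Fin m) → Bool) (S : Finset (Fin m)) :
    pullGraph (vertexMap e) H₁ H₀ (configGraph ω ⊔ cliqueOn S) = configGraph
      (splice (fun x => plantBlocks (offDiagPairs m) (insidePairs S) ω (Sym2.map (vertexMap e) x))
        H₁ H₀) := by
  ext x y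
  by_cases hxy : vertexMap e x = vertexMap e y
  · simp [pullGraph, configGraph, splice, plantBlocks, offDiagPairs, hxy]
  · by_cases hω : ω s(vertexMap e x, vertexMap e y) = true <;>
    by_cases hS : vertexMap e x ∈ S ∧ vertexMap e y ∈ S <;>
    simp only [pullGraph, configGraph, cliqueOn, splice, plantBlocks, offDiagPairs,
      mk_mem_insidePairs, hω, hS, Sym2.map_mk, SimpleGraph.sup_adj] <;>
    simp [hxy]

theorem pullGraph_configGraph (e : Fin N ≃ Fin m × Fin L) (H₁ H₀ : Sym2 (Fin N) → Bool)
    (ω : Sym2 (Fin m) → Bool) :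
    pullGraph (vertexMap e) H₁ H₀ (configGraph ω) = configGraph
      (splice (fun x => plantBlocks (offDiagPairs m) ∅ ω (Sym2.map (vertexMap e) x)) H₁ H₀) := by
  classical
  ext x y
  by_cases hxy : vertexMap e x = vertexMap e y
  · simp [pullGraph, configGraph, splice, plantBlocks, offDiagPairs, hxy]
  · by_cases hω : ω s(vertexMap e x, vertexMap e y) = true <;>
    simp [pullGraph, configGraph, splice, plantBlocks, offDiagPairs, hxy, hω]

/-- The vertices whose label lies over `S`. -/
def plantedSet (e : Fin N ≃ Fin m × Fin L) (S : Finset (Fin m)) : Finset (Fin N) :=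
  Finset.univ.filter fun v => vertexMap e v ∈ S

theorem mem_plantedSet (e : Fin N ≃ Fin m × Fin L) (S : Finset (Fin m)) (v : Fin N) :
    v ∈ plantedSet e S ↔ (e v).1 ∈ S :=
  Finset.mem_filter.trans (and_iff_right (Finset.mem_univ v))

/-- The permutation of the labels that acts by `τ a` on the labels `(i, a)` with `i ∈ S`. -/
def layerPerm (S : Finset (Fin m)) (τ : Fin L → Equiv.Perm S) : Equiv.Perm (Fin m × Fin L) where
  toFun x := (Equiv.Perm.ofSubtype (τ x.2) x.1, x.2)
  invFun x := ((Equiv.Perm.ofSubtype (τ x.2)).symm x.1, x.2)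
  left_inv x := by simp
  right_inv x := by simp

/-- The layer permutations move only labels over `S`, and keep them over `S`. So they can be
averaged with the planted set held fixed, while the merged pairs become random. -/
theorem plantedSet_trans_layerPerm (e : Fin N ≃ Fin m × Fin L) (S : Finset (Fin m))
    (τ : Fin L → Equiv.Perm S) : plantedSet (e.trans (layerPerm S τ)) S = plantedSet e S := by
  ext v
  rw [mem_plantedSet, mem_plantedSet]
  exact Equiv.Perm.ofSubtype_apply_mem_iff_mem (τ (e v).2) (e v).1

open Classical in
/-- The pairs of planted vertices that are merged by the relabelling. -/
noncomputable def mergedPairs (e : Fin N ≃ Fin m × Fin L) (S : Finset (Fin m))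
    (τ : Fin L → Equiv.Perm S) : Finset (Sym2 (Fin N)) :=
  (insidePairs (plantedSet e S)).filter fun x =>
    (Sym2.map (vertexMap (e.trans (layerPerm S τ))) x).IsDiag

theorem mk_mem_mergedPairs (e : Fin N ≃ Fin m × Fin L) (S : Finset (Fin m))
    (τ : Fin L → Equiv.Perm S) (u v : Fin N) :
    s(u, v) ∈ mergedPairs e S τ ↔ (u ≠ v ∧ (e u).1 ∈ S ∧ (e v).1 ∈ S) ∧
      Equiv.Perm.ofSubtype (τ (e u).2) (e u).1 = Equiv.Perm.ofSubtype (τ (e v).2) (e v).1 := by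
  rw [mergedPairs, Finset.mem_filter, mk_mem_insidePairs, mem_plantedSet, mem_plantedSet,
    Sym2.map_mk, Sym2.mk_isDiag_iff]
  rfl

theorem filter_map_mem_insidePairs (e : Fin N ≃ Fin m × Fin L) (S : Finset (Fin m))
    (τ : Fin L → Equiv.Perm S) :
    (Finset.univ.filter fun x =>
      Sym2.map (vertexMap (e.trans (layerPerm S τ))) x ∈ insidePairs S) =
      insidePairs (plantedSet e S) \ mergedPairs e S τ := by
  classical
  rw [← plantedSet_trans_layerPerm e S τ, mergedPairs, ← plantedSet_trans_layerPerm e S τ,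
    ← Finset.filter_not]
  generalize e.trans (layerPerm S τ) = e'
  ext x
  induction x using Sym2.ind with
  | _ u v =>
    simp only [insidePairs, plantedSet, Finset.mem_filter, Finset.mem_univ, true_and,
      Sym2.map_mk, Sym2.mk_isDiag_iff, Sym2.mem_iff, forall_eq_or_imp, forall_eq]
    constructor
    · rintro ⟨h1, h2⟩
      exact ⟨⟨fun h => h1 (by rw [h]), h2⟩, h1⟩
    · rintro ⟨⟨_, h2⟩, h1⟩
      exact ⟨h1, h2⟩

/-- Labels `(i, a)` and `(j, b)` are merged by `τ` exactly if `j = (τ b)⁻¹ (τ a i)`. A pair merged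
by both `τ` and `τ'` is thus determined by `a`, `b` and an `i` on which the two permutations agree.
The layers differ because `τ a` is injective. -/
theorem card_mergedPairs_inter_le (e : Fin N ≃ Fin m × Fin L) (S : Finset (Fin m))
    (τ τ' : Fin L → Equiv.Perm S) :
    (mergedPairs e S τ ∩ mergedPairs e S τ').card ≤
      ∑ a, ∑ b ∈ Finset.univ.erase a, agreeCount τ τ' a b := by
  classical
  have hsub : mergedPairs e S τ ∩ mergedPairs e S τ' ⊆
      Finset.univ.biUnion fun a => (Finset.univ.erase a).biUnion fun b =>
        (Finset.univ.filter fun i : S => (τ b)⁻¹ (τ a i) = (τ' b)⁻¹ (τ' a i)).image fun i : S =>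
          s(e.symm ((i : Fin m), a), e.symm ((((τ b)⁻¹ (τ a i) : S) : Fin m), b)) := by
    intro x hx
    induction x using Sym2.ind with
    | _ u v =>
      rw [Finset.mem_inter, mk_mem_mergedPairs, mk_mem_mergedPairs] at hx
      obtain ⟨⟨⟨huv, hu, hv⟩, h1⟩, ⟨-, h2⟩⟩ := hx
      rw [Equiv.Perm.ofSubtype_apply_of_mem _ hu, Equiv.Perm.ofSubtype_apply_of_mem _ hv,
        Subtype.coe_inj] at h1 h2
      have h1' : (τ (e v).2)⁻¹ (τ (e u).2 ⟨(e u).1, hu⟩) = ⟨(e v).1, hv⟩ := by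
        rw [Equiv.Perm.inv_eq_iff_eq]; exact h1
      have h2' : (τ' (e v).2)⁻¹ (τ' (e u).2 ⟨(e u).1, hu⟩) = ⟨(e v).1, hv⟩ := by
        rw [Equiv.Perm.inv_eq_iff_eq]; exact h2
      have hne : (e v).2 ≠ (e u).2 := by
        intro h
        rw [h] at h1
        have h3 := (τ (e u).2).injective h1
        exact huv (e.injective (Prod.ext (congrArg Subtype.val h3) h.symm))
      refine Finset.mem_biUnion.mpr ⟨(e u).2, Finset.mem_univ _, Finset.mem_biUnion.mpr
        ⟨(e v).2, Finset.mem_erase.mpr ⟨hne, Finset.mem_univ _⟩, Finset.mem_image.mpr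
          ⟨⟨(e u).1, hu⟩, Finset.mem_filter.mpr ⟨Finset.mem_univ _, h1'.trans h2'.symm⟩, ?_⟩⟩⟩
      rw [h1']
      simp
  refine (Finset.card_le_card hsub).trans (Finset.card_biUnion_le.trans ?_)
  refine Finset.sum_le_sum fun a _ => Finset.card_biUnion_le.trans ?_
  exact Finset.sum_le_sum fun b _ => Finset.card_image_le

theorem card_plantedSet (e : Fin N ≃ Fin m × Fin L) (S : Finset (Fin m)) :
    (plantedSet e S).card = S.card * L := by
  have : (plantedSet e S).map e.toEmbedding = S ×ˢ Finset.univ := by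
    ext x
    simp only [mem_plantedSet, Finset.mem_map, Finset.mem_univ, Finset.mem_product, and_true,
      Equiv.coe_toEmbedding]
    constructor
    · rintro ⟨v, hv, rfl⟩; exact hv
    · intro h; exact ⟨e.symm x, by simpa using h, by simp⟩
  rw [← Finset.card_map e.toEmbedding, this, Finset.card_product, Finset.card_univ,
    Fintype.card_fin]

/-- The planted set of a uniformly random labelling is a uniformly random set. -/
theorem avg_plantedSet [Nonempty (Fin N ≃ Fin m × Fin L)] (S : Finset (Fin m))
    (Ψ : Finset (Fin N) → ℝ) :
    (Fintype.card (Fin N ≃ Fin m × Fin L) : ℝ)⁻¹ * ∑ e : Fin N ≃ Fin m × Fin L,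
        Ψ (plantedSet e S) =
      ((N.choose (S.card * L) : ℕ) : ℝ)⁻¹ *
        ∑ U ∈ Finset.powersetCard (S.card * L) Finset.univ, Ψ U := by
  classical
  set E := Fin N ≃ Fin m × Fin L
  obtain ⟨e₀⟩ := ‹Nonempty E›
  have hcardE : (0 : ℝ) < Fintype.card E := by exact_mod_cast Fintype.card_pos_iff.mpr ⟨e₀⟩
  set P := Finset.powersetCard (S.card * L) (Finset.univ : Finset (Fin N)) with hP
  have hPcard : P.card = N.choose (S.card * L) := by
    rw [hP, Finset.card_powersetCard, Finset.card_univ, Fintype.card_fin]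
  have hPpos : (0 : ℝ) < P.card := by
    have : plantedSet e₀ S ∈ P :=
      Finset.mem_powersetCard.mpr ⟨Finset.subset_univ _, card_plantedSet e₀ S⟩
    exact_mod_cast Finset.card_pos.mpr ⟨_, this⟩
  have hmap : ∀ (g : Equiv.Perm (Fin N)) (e : E),
      plantedSet (g.symm.trans e) S = (plantedSet e S).map g.toEmbedding := by
    intro g e
    ext v
    simp only [mem_plantedSet, Finset.mem_map, Equiv.trans_apply, Equiv.coe_toEmbedding]
    constructor
    · intro h; exact ⟨g.symm v, h, by simp⟩
    · rintro ⟨w, hw, rfl⟩; simpa using hw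
  have htrans : ∀ g : Equiv.Perm (Fin N), ∑ e : E, Ψ ((plantedSet e S).map g.toEmbedding) =
      ∑ e : E, Ψ (plantedSet e S) := by
    intro g
    simp only [← hmap]
    let F : E ≃ E := ⟨fun e => g.symm.trans e, fun e => g.trans e,
      fun e => by ext1 x; simp, fun e => by ext1 x; simp⟩
    exact Equiv.sum_comp F (fun e => Ψ (plantedSet e S))
  -- The permutations of the vertices act transitively on sets of the given size, so the average
  -- over `P` equals the average over the orbit of any one planted set.
  have hsum : ∀ e : E, ∑ U ∈ P, Ψ U =
      ((P.card : ℝ) / (Nat.factorial N : ℝ)) *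
        ∑ g : Equiv.Perm (Fin N), Ψ ((plantedSet e S).map g.toEmbedding) := by
    intro e
    have hconst : ∀ U ∈ P, ∑ g : Equiv.Perm (Fin N), Ψ (U.map g.toEmbedding) =
        ∑ g : Equiv.Perm (Fin N), Ψ ((plantedSet e S).map g.toEmbedding) := by
      intro U hU
      have hc : Fintype.card {v // v ∈ plantedSet e S} = Fintype.card {v // v ∈ U} := by
        rw [Fintype.card_coe, Fintype.card_coe, card_plantedSet, (Finset.mem_powersetCard.mp hU).2]
      let h := (Fintype.equivOfCardEq hc).extendSubtype
      have hU' : (plantedSet e S).map h.toEmbedding = U := by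
        refine Finset.eq_of_subset_of_card_le ?_ ?_
        · intro v hv
          obtain ⟨w, hw, rfl⟩ := Finset.mem_map.mp hv
          exact Equiv.extendSubtype_mem _ w hw
        · rw [Finset.card_map, card_plantedSet, (Finset.mem_powersetCard.mp hU).2]
      rw [← hU', ← Equiv.sum_comp (Equiv.mulRight h)
        (fun g : Equiv.Perm (Fin N) => Ψ ((plantedSet e S).map g.toEmbedding))]
      refine Finset.sum_congr rfl fun g _ => ?_
      rw [Finset.map_map]
      rfl
    have hinv : ∀ g : Equiv.Perm (Fin N), ∑ U ∈ P, Ψ (U.map g.toEmbedding) = ∑ U ∈ P, Ψ U := by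
      intro g
      refine Finset.sum_nbij' (fun U => U.map g.toEmbedding) (fun U => U.map g.symm.toEmbedding)
        ?_ ?_ ?_ ?_ ?_
      · intro U hU
        simpa [hP, Finset.mem_powersetCard] using hU
      · intro U hU
        simpa [hP, Finset.mem_powersetCard] using hU
      · intro U _; ext v; simp
      · intro U _; ext v; simp
      · intro U _; rfl
    have h1 : ∑ U ∈ P, ∑ g : Equiv.Perm (Fin N), Ψ (U.map g.toEmbedding) =
        (P.card : ℝ) * ∑ g : Equiv.Perm (Fin N), Ψ ((plantedSet e S).map g.toEmbedding) := by
      rw [Finset.sum_congr rfl hconst, Finset.sum_const, nsmul_eq_mul]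
    have h2 : ∑ U ∈ P, ∑ g : Equiv.Perm (Fin N), Ψ (U.map g.toEmbedding) =
        (Nat.factorial N : ℝ) * ∑ U ∈ P, Ψ U := by
      rw [Finset.sum_comm, Finset.sum_congr rfl fun g _ => hinv g, Finset.sum_const,
        Finset.card_univ, Fintype.card_perm, Fintype.card_fin, nsmul_eq_mul]
    have hN : (Nat.factorial N : ℝ) ≠ 0 := by exact_mod_cast Nat.factorial_ne_zero N
    rw [h1] at h2
    field_simp
    linarith
  have h3 : (Fintype.card E : ℝ) * ∑ U ∈ P, Ψ U = (P.card : ℝ) * ∑ e : E, Ψ (plantedSet e S) := by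
    have hN : (Nat.factorial N : ℝ) ≠ 0 := by exact_mod_cast Nat.factorial_ne_zero N
    calc (Fintype.card E : ℝ) * ∑ U ∈ P, Ψ U = ∑ _e : E, ∑ U ∈ P, Ψ U := by
          rw [Finset.sum_const, Finset.card_univ, nsmul_eq_mul]
      _ = ∑ e : E, ((P.card : ℝ) / (Nat.factorial N : ℝ)) *
            ∑ g : Equiv.Perm (Fin N), Ψ ((plantedSet e S).map g.toEmbedding) :=
          Finset.sum_congr rfl fun e _ => hsum e
      _ = ((P.card : ℝ) / (Nat.factorial N : ℝ)) * ∑ g : Equiv.Perm (Fin N),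
            ∑ e : E, Ψ ((plantedSet e S).map g.toEmbedding) := by
          rw [← Finset.mul_sum, Finset.sum_comm]
      _ = _ := by
          rw [Finset.sum_congr rfl fun g _ => htrans g, Finset.sum_const, Finset.card_univ,
            Fintype.card_perm, Fintype.card_fin, nsmul_eq_mul]
          field_simp
  rw [← hPcard, inv_mul_eq_div, inv_mul_eq_div, div_eq_div_iff hcardE.ne' hPpos.ne']
  linarith

end Reduction

/-! ### The error of the reduction at a fixed size -/

section Transfer

variable {m L N : ℕ}

theorem card_filter_map_vertexMap_le (e : Fin N ≃ Fin m × Fin L) (B : Sym2 (Fin m)) :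
    (Finset.univ.filter fun x => Sym2.map (vertexMap e) x = B).card ≤ L ^ 2 := by
  classical
  induction B using Sym2.ind with
  | _ i j =>
    have hsub : (Finset.univ.filter fun x => Sym2.map (vertexMap e) x = s(i, j)) ⊆
        (Finset.univ : Finset (Fin L × Fin L)).image
          fun p => s(e.symm (i, p.1), e.symm (j, p.2)) := by
      intro x hx
      have h := (Finset.mem_filter.mp hx).2
      induction x using Sym2.ind with
      | _ u v =>
        rw [Sym2.map_mk, Sym2.eq_iff] at h
        rcases h with ⟨h1, h2⟩ | ⟨h1, h2⟩
        · refine Finset.mem_image.mpr ⟨((e u).2, (e v).2), Finset.mem_univ _, ?_⟩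
          subst h1 h2
          simp [vertexMap]
        · refine Finset.mem_image.mpr ⟨((e v).2, (e u).2), Finset.mem_univ _, ?_⟩
          subst h1 h2
          simp only [vertexMap, Prod.mk.eta, Equiv.symm_apply_apply]
          exact Sym2.eq_swap
    refine (Finset.card_le_card hsub).trans (Finset.card_image_le.trans ?_)
    simp [sq]

/-- The expansion of a planted clique is close to a planted dense subgraph, on average over the
labellings. -/
theorem sum_bernExp_expansion_le {c q : ℝ} (hc : 1 < c) (hq : 0 < q) (hcq : c * q ≤ 1 / 2)
    (hL : 0 < L) (S : Finset (Fin m)) {Δ : ℝ}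
    (hΔ : Real.exp ((Real.exp (2 * (c * q) * L) - 1) * (1 + Real.log S.card)) ^ (L - 1) ≤ 1 + Δ)
    (f : (Sym2 (Fin N) → Bool) → ℝ) (hf0 : ∀ ω, 0 ≤ f ω) (hf1 : ∀ ω, f ω ≤ 1) :
    ∑ e : Fin N ≃ Fin m × Fin L, bernExp (fun _ => q) (fun H => f H *
        ∏ x with Sym2.map (vertexMap e) x ∈ insidePairs S, bernRatio c q (H x)) ≤
      ∑ e : Fin N ≃ Fin m × Fin L, (bernExp (fun _ => q) (fun H => f H *
        ∏ x ∈ insidePairs (plantedSet e S), bernRatio c q (H x)) + Real.sqrt Δ) := by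
  classical
  set Ψ : (Fin N ≃ Fin m × Fin L) → ℝ := fun e => bernExp (fun _ => q) (fun H => f H *
    ∏ x with Sym2.map (vertexMap e) x ∈ insidePairs S, bernRatio c q (H x)) with hΨ
  set κ := Fin L → Equiv.Perm S
  have hκ : (0 : ℝ) < Fintype.card κ := by exact_mod_cast Fintype.card_pos
  have hshift : ∀ τ : κ, ∑ e : Fin N ≃ Fin m × Fin L, Ψ (e.trans (layerPerm S τ)) =
      ∑ e, Ψ e := by
    intro τ
    let F : (Fin N ≃ Fin m × Fin L) ≃ (Fin N ≃ Fin m × Fin L) :=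
      ⟨fun e => e.trans (layerPerm S τ), fun e => e.trans (layerPerm S τ).symm,
        fun e => by ext1 x; simp, fun e => by ext1 x; simp⟩
    exact Equiv.sum_comp F Ψ
  -- Composing with a layer permutation is a bijection of the labellings, so an extra average over
  -- `τ` can be inserted for free.
  have h1 : ∑ e, Ψ e = ∑ e : Fin N ≃ Fin m × Fin L, (Fintype.card κ : ℝ)⁻¹ *
      ∑ τ : κ, Ψ (e.trans (layerPerm S τ)) := by
    rw [← Finset.mul_sum, Finset.sum_comm, Finset.sum_congr rfl fun τ _ => hshift τ,
      Finset.sum_const, Finset.card_univ, nsmul_eq_mul]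
    field_simp
  rw [h1]
  refine Finset.sum_le_sum fun e _ => ?_
  simp only [hΨ, filter_map_mem_insidePairs]
  refine avg_bernExp_sdiff_le hc hq hcq (insidePairs (plantedSet e S)) (mergedPairs e S)
    (fun τ => Finset.filter_subset _ _) f hf0 hf1 ?_
  have hθ : 0 ≤ 2 * (c * q) := by positivity
  have h2 := sum_sum_exp_agreeCount_le (σ := S) hL hθ
  rw [Fintype.card_coe] at h2
  refine le_trans (Finset.sum_le_sum fun τ _ => Finset.sum_le_sum fun τ' _ => ?_)
    (h2.trans (mul_le_mul_of_nonneg_left hΔ (sq_nonneg _)))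
  apply Real.exp_le_exp.mpr
  refine mul_le_mul_of_nonneg_left ?_ hθ
  exact_mod_cast card_mergedPairs_inter_le e S τ τ'

/-- Averaging over the labellings gives the planted dense subgraph law. -/
theorem avg_bernExp_insidePairs [Nonempty (Fin N ≃ Fin m × Fin L)] {c q : ℝ} (hc : 1 < c)
    (hq : 0 < q) (hcq : c * q < 1) (S : Finset (Fin m)) (a : SimpleGraph (Fin N) → ℝ) :
    (Fintype.card (Fin N ≃ Fin m × Fin L) : ℝ)⁻¹ * ∑ e : Fin N ≃ Fin m × Fin L,
        bernExp (fun _ => q) (fun H => a (configGraph H) *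
          ∏ x ∈ insidePairs (plantedSet e S), bernRatio c q (H x)) =
      ((N.choose (S.card * L) : ℕ) : ℝ)⁻¹ *
        ∑ U ∈ Finset.powersetCard (S.card * L) Finset.univ,
          bernExp (plantedProb U (c * q) q) (fun H => a (configGraph H)) := by
  classical
  rw [← avg_plantedSet S (fun U => bernExp (plantedProb U (c * q) q) fun H => a (configGraph H))]
  congr 1
  refine Finset.sum_congr rfl fun e _ => ?_
  rw [bernExp_mul_prod_bernRatio hc hq hcq]
  -- `plantedProb` also raises the diagonal pairs of `U`, which `insidePairs` omits; the graph does
  -- not see them.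
  refine bernExp_congr_of_dependsOnly (fun x => ¬ x.IsDiag) ?_ ?_
  · intro x hx
    simp [insidePairs, plantedProb, hx]
  · intro ω ω' h
    refine congrArg a ((configGraph_eq_iff ω _).mpr ?_)
    intro x hx
    rw [h x hx]
    exact (configGraph_eq_iff ω' _).mp rfl x hx

/-- Every test for planted dense subgraph gives a test for planted clique on a smaller graph with
almost the same error. -/
theorem exists_errorPC_le {m L N k W : ℕ} (hN : N = m * L) (hk : k ≤ m) (hL : 0 < L) {c : ℝ} (hc : 1 < c)
    {γ p q : unitInterval} (hq : 0 < (q : ℝ)) (hp : (p : ℝ) = c * q) (hcq : c * (q : ℝ) ≤ 1 / 2)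
    (hγ : (γ : ℝ) * (c ^ W + 1) ≤ 1) {η Δ : ℝ} (hη0 : 0 ≤ η)
    (hη : ∀ (e : Fin N ≃ Fin m × Fin L) (B : Sym2 (Fin m)),
      blockDefect (Sym2.map (vertexMap e)) c (q : ℝ) W B ≤ η)
    (hΔ : Real.exp ((Real.exp (2 * (c * (q : ℝ)) * L) - 1) * (1 + Real.log k)) ^ (L - 1) ≤ 1 + Δ)
    (φ : RandomizedTest N) :
    ∃ A : RandomizedTest m, A.cost ≤ 2 * φ.cost ∧
      errorPC m k γ A ≤ errorPDS N (k * L) p q φ + (k ^ 2 * η + Real.sqrt Δ) := by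
  classical
  have hcq' : c * (q : ℝ) < 1 := by linarith
  have hγ0 : 0 ≤ (γ : ℝ) := γ.2.1
  have hγ1 : (γ : ℝ) < 1 := by
    have : 1 ≤ c ^ W := one_le_pow₀ hc.le
    nlinarith
  let E := Fin N ≃ Fin m × Fin L
  let Ω := Sym2 (Fin N) → Bool
  have : Nonempty E := ⟨(finCongr hN).trans finProdFinEquiv.symm⟩
  have hE : (0 : ℝ) < Fintype.card E := by exact_mod_cast Fintype.card_pos
  set a : Ω → ℝ := fun H => φ.acceptProb (configGraph H) with ha
  set a' : Ω → ℝ := fun H => 1 - φ.acceptProb (configGraph H) with ha'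
  have ha'0 : ∀ H, 0 ≤ a' H := fun H => by
    have := φ.acceptProb_le_one (configGraph H); simp only [ha']; linarith
  have ha'1 : ∀ H, a' H ≤ 1 := fun H => by
    have := φ.acceptProb_nonneg (configGraph H); simp only [ha']; linarith
  set b : E → Sym2 (Fin N) → Sym2 (Fin m) := fun e => Sym2.map (vertexMap e) with hb
  set Sets := Finset.powersetCard k (Finset.univ : Finset (Fin m)) with hSets
  have hcardS : (Sets.card : ℝ) = (m.choose k : ℝ) := by
    rw [hSets, Finset.card_powersetCard, Finset.card_univ, Fintype.card_fin]
  have hchoose : (0 : ℝ) < (m.choose k : ℝ) := by exact_mod_cast Nat.choose_pos hk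
  set w : E → Ω → Ω → ℝ := fun e H₁ H₀ =>
    seedWeight (b e) (offDiagPairs m) c q γ W H₁ H₀ with hw
  have herr : ∀ (e : E) (H₁ H₀ : Ω), errorPC m k γ (φ.pull (vertexMap e) H₁ H₀) =
      bernExp (fun _ => (γ : ℝ)) (fun ω => a (splice (fun x =>
        plantBlocks (offDiagPairs m) ∅ ω (b e x)) H₁ H₀)) +
      ((m.choose k : ℝ))⁻¹ * ∑ S ∈ Sets, bernExp (fun _ => (γ : ℝ)) (fun ω => a' (splice (fun x =>
        plantBlocks (offDiagPairs m) (insidePairs S) ω (b e x)) H₁ H₀)) := by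
    intro e H₁ H₀
    simp only [errorPC, RandomizedTest.error, integral_binomialRandom, integral_plantedClique,
      RandomizedTest.acceptProb_pull, pullGraph_configGraph, pullGraph_configGraph_sup, ha, ha', hb,
      hSets]
  have hinner : ∀ e : E, ∑ H₁, ∑ H₀, w e H₁ H₀ * errorPC m k γ (φ.pull (vertexMap e) H₁ H₀) =
      bernExp (fun _ => (q : ℝ)) a + ((m.choose k : ℝ))⁻¹ * ∑ S ∈ Sets,
        bernExp (fun _ => (q : ℝ)) (fun H => a' H * ∏ B ∈ insidePairs S,
          openDensity (b e) (offDiagPairs m) c q W B H) := by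
    intro e
    simp only [herr, mul_add, Finset.sum_add_distrib]
    congr 1
    · rw [sum_seedWeight_bernExp (b e) (offDiagPairs m) hγ1 (Finset.empty_subset _) a]
      simp
    · rw [Finset.mul_sum]
      simp only [← sum_seedWeight_bernExp (b e) (offDiagPairs m) hγ1 (insidePairs_subset _) a',
        hw, Finset.mul_sum]
      conv_rhs => rw [Finset.sum_comm]
      refine Finset.sum_congr rfl fun H₁ _ => ?_
      conv_rhs => rw [Finset.sum_comm]
      refine Finset.sum_congr rfl fun H₀ _ => Finset.sum_congr rfl fun S _ => by ring
  have hopen : ∀ (e : E) (S : Finset (Fin m)), S ∈ Sets →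
      bernExp (fun _ => (q : ℝ)) (fun H => a' H * ∏ B ∈ insidePairs S,
        openDensity (b e) (offDiagPairs m) c q W B H) ≤
      bernExp (fun _ => (q : ℝ)) (fun H => a' H * ∏ x with b e x ∈ insidePairs S,
        bernRatio c q (H x)) + k ^ 2 * η := by
    intro e S hS
    refine (bernExp_mul_prod_openDensity_le (b e) (offDiagPairs m) hc hq hcq'
      (insidePairs_subset S) a' ha'0 ha'1).trans ?_
    have h1 : ∑ B ∈ insidePairs S, blockDefect (b e) c (q : ℝ) W B ≤
        ((insidePairs S).card : ℝ) * η := by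
      rw [← nsmul_eq_mul]
      exact Finset.sum_le_card_nsmul _ _ _ fun B _ => hη e B
    have h2 : ((insidePairs S).card : ℝ) ≤ (k : ℝ) ^ 2 := by
      have := card_insidePairs_le S
      rw [(Finset.mem_powersetCard.mp hS).2] at this
      exact_mod_cast this
    have h3 := mul_le_mul_of_nonneg_right h2 hη0
    linarith
  have hS : ∀ S ∈ Sets, (Fintype.card E : ℝ)⁻¹ * ∑ e : E,
      bernExp (fun _ => (q : ℝ)) (fun H => a' H * ∏ B ∈ insidePairs S,
        openDensity (b e) (offDiagPairs m) c q W B H) ≤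
      ((N.choose (k * L) : ℕ) : ℝ)⁻¹ * ∑ U ∈ Finset.powersetCard (k * L) Finset.univ,
        bernExp (plantedProb U (c * q) q) a' + (k ^ 2 * η + Real.sqrt Δ) := by
    intro S hS
    have hcard : S.card = k := (Finset.mem_powersetCard.mp hS).2
    have h1 := sum_bernExp_expansion_le (N := N) hc hq hcq hL S (Δ := Δ)
      (by rw [hcard]; exact hΔ) a' ha'0 ha'1
    have h2 := avg_bernExp_insidePairs (N := N) (L := L) hc hq hcq' S
      (fun G => 1 - φ.acceptProb G)
    rw [hcard] at h2
    rw [Finset.sum_add_distrib, Finset.sum_const, Finset.card_univ, nsmul_eq_mul] at h1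
    have h3 := Finset.sum_le_sum fun (e : E) (_ : e ∈ Finset.univ) => hopen e S hS
    rw [Finset.sum_add_distrib, Finset.sum_const, Finset.card_univ, nsmul_eq_mul] at h3
    have h4 := mul_le_mul_of_nonneg_left (h3.trans (add_le_add_left h1 _)) (inv_nonneg.mpr hE.le)
    refine h4.trans (le_of_eq ?_)
    rw [mul_add, mul_add, inv_mul_cancel_left₀ hE.ne', inv_mul_cancel_left₀ hE.ne']
    rw [show ((Fintype.card E : ℝ))⁻¹ * ∑ e : E, bernExp (fun _ => (q : ℝ)) (fun H => a' H *
      ∏ x ∈ insidePairs (plantedSet e S), bernRatio c q (H x)) = _ from h2]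
    ring
  have hPDS : errorPDS N (k * L) p q φ = bernExp (fun _ => (q : ℝ)) a +
      ((N.choose (k * L) : ℕ) : ℝ)⁻¹ * ∑ U ∈ Finset.powersetCard (k * L) Finset.univ,
        bernExp (plantedProb U (c * q) q) a' := by
    simp only [errorPDS, RandomizedTest.error, integral_binomialRandom, integral_plantedDense, hp,
      ha, ha']
    rfl
  have htotal : ∑ e : E, (Fintype.card E : ℝ)⁻¹ *
      ∑ H₁, ∑ H₀, w e H₁ H₀ * errorPC m k γ (φ.pull (vertexMap e) H₁ H₀) ≤
      errorPDS N (k * L) p q φ + (k ^ 2 * η + Real.sqrt Δ) := by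
    simp only [hinner, mul_add, Finset.sum_add_distrib, Finset.sum_const, Finset.card_univ,
      nsmul_eq_mul]
    rw [mul_inv_cancel_left₀ hE.ne', hPDS, add_assoc]
    gcongr
    have h1 : ∑ e : E, (Fintype.card E : ℝ)⁻¹ * (((m.choose k : ℝ))⁻¹ * ∑ S ∈ Sets,
        bernExp (fun _ => (q : ℝ)) (fun H => a' H * ∏ B ∈ insidePairs S,
          openDensity (b e) (offDiagPairs m) c q W B H)) =
        ((m.choose k : ℝ))⁻¹ * ∑ S ∈ Sets, ((Fintype.card E : ℝ)⁻¹ * ∑ e : E,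
          bernExp (fun _ => (q : ℝ)) (fun H => a' H * ∏ B ∈ insidePairs S,
            openDensity (b e) (offDiagPairs m) c q W B H)) := by
      simp only [Finset.mul_sum]
      rw [Finset.sum_comm]
      exact Finset.sum_congr rfl fun S _ => Finset.sum_congr rfl fun e _ => by ring
    rw [h1, inv_mul_le_iff₀ hchoose, ← hcardS, ← nsmul_eq_mul]
    exact Finset.sum_le_card_nsmul _ _ _ hS
  -- First the labelling, then the two resampled configurations are fixed; they become constants of
  -- the circuit.
  obtain ⟨e, he⟩ := exists_le_of_weighted_sum_le (fun _ : E => (Fintype.card E : ℝ)⁻¹) _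
    (fun _ => by positivity) (by simp [hE.ne']) htotal
  rw [← Fintype.sum_prod_type'
    (f := fun H₁ H₀ => w e H₁ H₀ * errorPC m k γ (φ.pull (vertexMap e) H₁ H₀))] at he
  obtain ⟨⟨H₁, H₀⟩, hH⟩ := exists_le_of_weighted_sum_le (fun H : Ω × Ω => w e H.1 H.2)
    (fun H => errorPC m k γ (φ.pull (vertexMap e) H.1 H.2))
    (fun H => seedWeight_nonneg (b e) (offDiagPairs m) hc hq hcq' hγ0 hγ1 hγ H.1 H.2)
    (by rw [Fintype.sum_prod_type]; exact sum_seedWeight (b e) (offDiagPairs m) hγ1) he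
  exact ⟨φ.pull (vertexMap e) H₁ H₀, φ.cost_pull_le _ _ _, hH⟩

end Transfer

/-! ### Transfer of asymptotic hardness -/

section LowerBound

theorem RandomizedTest.error_nonneg {n : ℕ} (A : RandomizedTest n)
    (μ₀ μ₁ : Measure (SimpleGraph (Fin n))) : 0 ≤ A.error μ₀ μ₁ :=
  add_nonneg (integral_nonneg fun G => A.acceptProb_nonneg G)
    (integral_nonneg fun G => sub_nonneg.mpr (A.acceptProb_le_one G))

theorem plantedProb_nonneg {n : ℕ} (S : Finset (Fin n)) (p q : unitInterval) (x : Sym2 (Fin n)) :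
    0 ≤ plantedProb S (p : ℝ) q x := by
  unfold plantedProb
  split_ifs
  · exact p.2.1
  · exact q.2.1

theorem plantedProb_le_one {n : ℕ} (S : Finset (Fin n)) (p q : unitInterval) (x : Sym2 (Fin n)) :
    plantedProb S (p : ℝ) q x ≤ 1 := by
  unfold plantedProb
  split_ifs
  · exact p.2.2
  · exact q.2.2

/-- A bound for every fixed planted set is a bound for the planted law. -/
theorem integral_plantedDense_le {n k : ℕ} (hk : k ≤ n) (p q : unitInterval)
    (f : SimpleGraph (Fin n) → ℝ) {R : ℝ}
    (h : ∀ S : Finset (Fin n), S.card = k →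
      bernExp (plantedProb S (p : ℝ) q) (fun ω => f (configGraph ω)) ≤ R) :
    ∫ G, f G ∂(plantedDense n k p q) ≤ R := by
  rw [integral_plantedDense]
  have hchoose : (0 : ℝ) < (n.choose k : ℝ) := by exact_mod_cast Nat.choose_pos hk
  have := Finset.sum_le_card_nsmul (Finset.powersetCard k (Finset.univ : Finset (Fin n)))
    (fun S => bernExp (plantedProb S (p : ℝ) q) (fun ω => f (configGraph ω))) R
    (fun S hS => h S (Finset.mem_powersetCard.mp hS).2)
  rw [Finset.card_powersetCard, Finset.card_univ, Fintype.card_fin, nsmul_eq_mul] at this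
  rwa [inv_mul_le_iff₀ hchoose]

theorem errorPDS_le_two {n k : ℕ} (hk : k ≤ n) (p q : unitInterval) (A : RandomizedTest n) :
    errorPDS n k p q A ≤ 2 := by
  have h1 : ∫ G, A.acceptProb G ∂(SimpleGraph.binomialRandom (Fin n) q) ≤ 1 := by
    rw [integral_binomialRandom, ← bernExp_one (fun _ : Sym2 (Fin n) => (q : ℝ))]
    exact bernExp_mono (fun _ => q.2.1) (fun _ => q.2.2) fun ω => A.acceptProb_le_one _
  have h2 : ∫ G, (1 - A.acceptProb G) ∂(plantedDense n k p q) ≤ 1 := by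
    refine integral_plantedDense_le hk p q _ fun S _ => ?_
    refine (bernExp_mono (g := fun _ => 1) (plantedProb_nonneg S p q) (plantedProb_le_one S p q)
      fun ω => ?_).trans (bernExp_one _).le
    linarith [A.acceptProb_nonneg (configGraph ω)]
  unfold errorPDS RandomizedTest.error
  linarith

theorem Polynomial.eval_mono_nat (P : Polynomial ℕ) {a b : ℕ} (h : a ≤ b) :
    P.eval a ≤ P.eval b := by
  rw [Polynomial.eval_eq_sum_range, Polynomial.eval_eq_sum_range]
  exact Finset.sum_le_sum fun i _ => Nat.mul_le_mul_left _ (Nat.pow_le_pow_left h i)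

/-- Transfer of hardness along the expansion reduction. -/
theorem one_le_liminf_errorPDS {c : ℝ} (hc : 1 < c) {W T : ℕ} {γ : unitInterval}
    (hγ : (γ : ℝ) * (c ^ W + 1) ≤ 1) {N L k : ℕ → ℕ} {p q : ℕ → unitInterval} {η Δ : ℕ → ℝ}
    (hN : ∀ n, N n = (n + 1) * L n) (hNT : ∀ n, N n ≤ (n + 1) ^ T)
    (hL : ∀ n, 0 < L n) (hk0 : ∀ n, 0 < k n) (hk : ∀ n, k n ≤ n + 1)
    (hq : ∀ n, 0 < (q n : ℝ)) (hp : ∀ n, (p n : ℝ) = c * q n) (hcq : ∀ n, c * (q n : ℝ) ≤ 1 / 2)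
    (hη0 : ∀ n, 0 ≤ η n)
    (hη : ∀ n (e : Fin (N n) ≃ Fin (n + 1) × Fin (L n)) (B : Sym2 (Fin (n + 1))),
      blockDefect (Sym2.map (vertexMap e)) c (q n : ℝ) W B ≤ η n)
    (hΔ : ∀ n, Real.exp ((Real.exp (2 * (c * (q n : ℝ)) * L n) - 1) *
      (1 + Real.log (k n))) ^ (L n - 1) ≤ 1 + Δ n)
    (hη_lim : Tendsto (fun n => (k n : ℝ) ^ 2 * η n) atTop (𝓝 0))
    (hΔ_lim : Tendsto Δ atTop (𝓝 0)) {κ : ℝ} (hκ : κ < 1 / 2)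
    (hk_lim : Tendsto (fun n : ℕ => Real.logb ((n + 1 : ℕ) : ℝ) (k n)) atTop (𝓝 κ))
    (hPC : PCConjecture γ) (φ : ∀ n, RandomizedTest (N n)) (hφ : IsPolyTime φ) :
    1 ≤ liminf (fun n => errorPDS (N n) (k n * L n) (p n) (q n) (φ n)) atTop := by
  choose A hA_cost hA_err using fun n => exists_errorPC_le (hN n) (hk n) (hL n) hc (hq n) (hp n)
    (hcq n) hγ (hη0 n) (hη n) (hΔ n) (φ n)
  -- The reduction at index `n` uses base graphs on `n + 1` vertices, whence the shift; size `0`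
  -- gets a dummy test.
  let A' : ∀ n, RandomizedTest n := fun n => match n with
    | 0 => ⟨0, []⟩
    | n + 1 => A n
  have hpoly : IsPolyTime A' := by
    obtain ⟨P, hP⟩ := hφ
    refine ⟨2 * P.comp (Polynomial.X ^ T), fun n => ?_⟩
    rcases n with _ | n
    · exact Nat.zero_le _
    · change (A n).cost ≤ _
      refine (hA_cost n).trans ?_
      simp only [Polynomial.eval_mul, Polynomial.eval_comp, Polynomial.eval_pow, Polynomial.eval_X,
        Polynomial.eval_ofNat]
      exact Nat.mul_le_mul_left 2 ((hP n).trans (P.eval_mono_nat (hNT n)))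
  have hlim : limsup (fun n : ℕ => ((Real.logb n (k (n - 1)) : ℝ) : EReal)) atTop <
      ((1 / 2 : ℝ) : EReal) := by
    have h1 : Tendsto (fun n : ℕ => Real.logb (n : ℝ) (k (n - 1))) atTop (𝓝 κ) := by
      rw [← tendsto_add_atTop_iff_nat 1]
      exact hk_lim
    have h2 := (continuous_coe_real_ereal.tendsto κ).comp h1
    rw [show limsup (fun n : ℕ => ((Real.logb n (k (n - 1)) : ℝ) : EReal)) atTop = (κ : EReal) from
      h2.limsup_eq]
    exact_mod_cast hκ
  have hlow := hPC A' hpoly (fun n => k (n - 1)) (fun n => hk0 _) hlim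
  have hδ : Tendsto (fun n => (k n : ℝ) ^ 2 * η n + Real.sqrt (Δ n)) atTop (𝓝 0) := by
    have := hη_lim.add ((Real.continuous_sqrt.tendsto 0).comp hΔ_lim)
    simpa using this
  have hKN : ∀ n, k n * L n ≤ N n := fun n => by
    rw [hN]; exact Nat.mul_le_mul_right _ (hk n)
  refine le_of_forall_lt fun a ha => ?_
  obtain ⟨a₁, ha₁, ha₁'⟩ := exists_between ha
  obtain ⟨a₂, ha₂, ha₂'⟩ := exists_between ha₁'
  refine lt_of_lt_of_le ha₁ (le_liminf_of_le ?_ ?_)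
  · exact (isBoundedUnder_of ⟨2, fun n => errorPDS_le_two (hKN n) _ _ _⟩).isCoboundedUnder_ge
  · have h1 : ∀ᶠ n in atTop, a₂ < errorPC n (k (n - 1)) γ (A' n) :=
      eventually_lt_of_lt_liminf (lt_of_lt_of_le ha₂' hlow)
        (isBoundedUnder_of ⟨0, fun n => RandomizedTest.error_nonneg _ _ _⟩)
    have h2 := (tendsto_add_atTop_nat 1).eventually h1
    have h3 : ∀ᶠ n in atTop, (k n : ℝ) ^ 2 * η n + Real.sqrt (Δ n) < a₂ - a₁ :=
      hδ.eventually_lt_const (by linarith)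
    filter_upwards [h2, h3] with n h2 h3
    have h4 := hA_err n
    have h5 : a₂ < errorPC (n + 1) (k n) γ (A n) := h2
    linarith

end LowerBound

/-! ### Choice of parameters and their asymptotics -/

section Asymptotics

theorem natCeil_rpow_bounds {x t : ℝ} (hx : 1 ≤ x) (ht : 0 ≤ t) :
    x ^ t ≤ (⌈x ^ t⌉₊ : ℝ) ∧ (⌈x ^ t⌉₊ : ℝ) ≤ 2 * x ^ t := by
  have h1 : 1 ≤ x ^ t := Real.one_le_rpow hx ht
  have h2 := Nat.ceil_lt_add_one (zero_le_one.trans h1)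
  exact ⟨Nat.le_ceil _, by linarith⟩

theorem tendsto_cast_add_one_atTop : Tendsto (fun n : ℕ => ((n + 1 : ℕ) : ℝ)) atTop atTop :=
  tendsto_natCast_atTop_atTop.comp (tendsto_add_atTop_nat 1)

/-- The logarithm of `⌈x ^ t⌉₊` in base `x` tends to `t` along the positive integers `x`. -/
theorem tendsto_log_natCeil_div_log {t : ℝ} (ht : 0 ≤ t) :
    Tendsto (fun n : ℕ => Real.log (⌈((n + 1 : ℕ) : ℝ) ^ t⌉₊ : ℝ) / Real.log ((n + 1 : ℕ) : ℝ))
      atTop (𝓝 t) := by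
  have hlog : Tendsto (fun n : ℕ => Real.log ((n + 1 : ℕ) : ℝ)) atTop atTop :=
    Real.tendsto_log_atTop.comp tendsto_cast_add_one_atTop
  have hup : Tendsto (fun n : ℕ => t + Real.log 2 / Real.log ((n + 1 : ℕ) : ℝ)) atTop (𝓝 t) := by
    have := (tendsto_const_nhds (x := t)).add (hlog.const_div_atTop (Real.log 2))
    simpa using this
  refine tendsto_of_tendsto_of_tendsto_of_le_of_le' tendsto_const_nhds hup ?_ ?_
  · filter_upwards [hlog.eventually_gt_atTop 0] with n hn
    have hx : (1 : ℝ) ≤ ((n + 1 : ℕ) : ℝ) := by exact_mod_cast Nat.succ_pos n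
    have hx0 : (0 : ℝ) < ((n + 1 : ℕ) : ℝ) := by linarith
    rw [le_div_iff₀ hn, ← Real.log_rpow hx0]
    exact Real.log_le_log (Real.rpow_pos_of_pos hx0 t) (natCeil_rpow_bounds hx ht).1
  · filter_upwards [hlog.eventually_gt_atTop 0] with n hn
    have hx : (1 : ℝ) ≤ ((n + 1 : ℕ) : ℝ) := by exact_mod_cast Nat.succ_pos n
    have hx0 : (0 : ℝ) < ((n + 1 : ℕ) : ℝ) := by linarith
    have hb := natCeil_rpow_bounds hx ht
    have hpos := Real.rpow_pos_of_pos hx0 t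
    rw [div_le_iff₀ hn, add_mul, div_mul_cancel₀ _ hn.ne', ← Real.log_rpow hx0,
      add_comm (Real.log _), ← Real.log_mul two_ne_zero hpos.ne']
    exact Real.log_le_log (by linarith) hb.2

theorem Filter.Tendsto.div_of_div {f g h : ℕ → ℝ} {a b : ℝ}
    (hf : Tendsto (fun n => f n / h n) atTop (𝓝 a))
    (hg : Tendsto (fun n => g n / h n) atTop (𝓝 b)) (hb : b ≠ 0) (hh : ∀ᶠ n in atTop, h n ≠ 0) :
    Tendsto (fun n => f n / g n) atTop (𝓝 (a / b)) := by
  refine (hf.div hg hb).congr' ?_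
  filter_upwards [hh] with n hn
  exact div_div_div_cancel_right₀ hn _ _

theorem tendsto_rpow_neg_mul_one_add_log {ε : ℝ} (hε : 0 < ε) :
    Tendsto (fun n : ℕ => ((n + 1 : ℕ) : ℝ) ^ (-ε) * (1 + Real.log ((n + 1 : ℕ) : ℝ)))
      atTop (𝓝 0) := by
  have h1 : Tendsto (fun x : ℝ => x ^ (-ε) * (1 + Real.log x)) atTop (𝓝 0) := by
    have h2 := tendsto_rpow_neg_atTop hε
    have h3 := (isLittleO_log_rpow_atTop hε).tendsto_div_nhds_zero
    have h4 := h2.add h3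
    rw [add_zero] at h4
    refine h4.congr' ?_
    filter_upwards [eventually_gt_atTop 0] with x hx
    rw [Real.rpow_neg hx.le]
    ring
  exact h1.comp tendsto_cast_add_one_atTop

/-- Hardness of planted dense subgraph along an explicit family of parameters. -/
theorem exists_regime_hard {c : ℝ} (hc : 1 < c) {t κ s : ℝ} (ht : 0 ≤ t) (hκ0 : 0 < κ)
    (hκ : κ < 1 / 2) (hs : 2 * t < s ∨ (t = 0 ∧ s = 0)) :
    ∃ (N K : ℕ → ℕ) (p q : ℕ → unitInterval),
      PDSRegime c (s / (1 + t)) ((κ + t) / (1 + t)) N K p q ∧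
      ((∀ γ : unitInterval, 0 < γ → (γ : ℝ) ≤ 1 / 2 → PCConjecture γ) →
        ∀ φ : ∀ n, RandomizedTest (N n), IsPolyTime φ →
          1 ≤ liminf (fun n => errorPDS (N n) (K n) (p n) (q n) (φ n)) atTop) := by
  have hc0 : 0 < c := by linarith
  have hs0 : 0 ≤ s := by rcases hs with h | h <;> linarith
  have hts : t ≤ s := by rcases hs with h | h <;> linarith
  set x : ℕ → ℝ := fun n => ((n + 1 : ℕ) : ℝ) with hx
  have hx1 : ∀ n, 1 ≤ x n := fun n => by simp only [hx]; exact_mod_cast Nat.succ_pos n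
  have hx0 : ∀ n, 0 < x n := fun n => by linarith [hx1 n]
  have hlog : Tendsto (fun n => Real.log (x n)) atTop atTop :=
    Real.tendsto_log_atTop.comp tendsto_cast_add_one_atTop
  have hlog0 : ∀ᶠ n in atTop, Real.log (x n) ≠ 0 := by
    filter_upwards [hlog.eventually_gt_atTop 0] with n hn using hn.ne'
  set L : ℕ → ℕ := fun n => ⌈x n ^ t⌉₊ with hL
  set k : ℕ → ℕ := fun n => ⌈x n ^ κ⌉₊ with hk
  have hxs : ∀ n, 0 < x n ^ (-s) ∧ x n ^ (-s) ≤ 1 := fun n =>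
    ⟨Real.rpow_pos_of_pos (hx0 n) _, Real.rpow_le_one_of_one_le_of_nonpos (hx1 n) (by linarith)⟩
  -- The factor `1 / 4` gives `c * q ≤ 1 / 2` and cancels the `4` from `L ^ 2 ≤ (2 * x ^ t) ^ 2` in
  -- `hν`.
  let p : ℕ → unitInterval := fun n => ⟨x n ^ (-s) / 4, by linarith [hxs n], by linarith [hxs n]⟩
  let q : ℕ → unitInterval := fun n => ⟨x n ^ (-s) / 4 / c,
    div_nonneg (by linarith [hxs n]) hc0.le, (div_le_one hc0).mpr (by linarith [hxs n])⟩
  have hpq : ∀ n, (p n : ℝ) = c * q n := fun n => by simp only [p, q]; field_simp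
  have hcq : ∀ n, c * (q n : ℝ) = x n ^ (-s) / 4 := fun n => by simp only [q]; field_simp
  have hq0 : ∀ n, 0 < (q n : ℝ) := fun n => div_pos (by linarith [hxs n]) hc0
  have hLb : ∀ n, x n ^ t ≤ L n ∧ (L n : ℝ) ≤ 2 * x n ^ t := fun n =>
    natCeil_rpow_bounds (hx1 n) ht
  have hkb : ∀ n, x n ^ κ ≤ k n ∧ (k n : ℝ) ≤ 2 * x n ^ κ := fun n =>
    natCeil_rpow_bounds (hx1 n) hκ0.le
  have hL0 : ∀ n, 0 < L n := fun n => Nat.ceil_pos.mpr (Real.rpow_pos_of_pos (hx0 n) _)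
  have hk0 : ∀ n, 0 < k n := fun n => Nat.ceil_pos.mpr (Real.rpow_pos_of_pos (hx0 n) _)
  have hkn : ∀ n, k n ≤ n + 1 := fun n => Nat.ceil_le.mpr <| by
    calc x n ^ κ ≤ x n ^ (1 : ℝ) := Real.rpow_le_rpow_of_exponent_le (hx1 n) (by linarith)
      _ = ((n + 1 : ℕ) : ℝ) := Real.rpow_one _
  have hL_lim : Tendsto (fun n => Real.log (L n) / Real.log (x n)) atTop (𝓝 t) :=
    tendsto_log_natCeil_div_log ht
  have hk_lim : Tendsto (fun n => Real.log (k n) / Real.log (x n)) atTop (𝓝 κ) :=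
    tendsto_log_natCeil_div_log hκ0.le
  have hN_lim : Tendsto (fun n => Real.log (((n + 1) * L n : ℕ) : ℝ) / Real.log (x n)) atTop
      (𝓝 (1 + t)) := by
    refine ((tendsto_const_nhds (x := (1 : ℝ))).add hL_lim).congr' ?_
    filter_upwards [hlog0] with n hn
    have hLn : (L n : ℝ) ≠ 0 := by exact_mod_cast (hL0 n).ne'
    rw [Nat.cast_mul, Real.log_mul (hx0 n).ne' hLn, add_div, div_self hn]
  refine ⟨fun n => (n + 1) * L n, fun n => k n * L n, p, q, ⟨?_, ?_, ?_, ?_, ?_, ?_, ?_⟩, ?_⟩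
  · refine tendsto_atTop_mono (fun n => ?_) tendsto_id
    have := hL0 n
    simp only [id]
    nlinarith
  · exact fun n => Nat.mul_pos (hk0 n) (hL0 n)
  · exact fun n => Nat.mul_le_mul_right _ (hkn n)
  · exact fun n => hq0 n
  · refine Filter.Tendsto.div_of_div (h := fun n => Real.log (x n)) ?_ hN_lim (by linarith) hlog0
    have h1 : Tendsto (fun n => s + Real.log (4 * c) / Real.log (x n)) atTop (𝓝 s) := by
      have := (tendsto_const_nhds (x := s)).add (hlog.const_div_atTop (Real.log (4 * c)))
      simpa using this
    refine h1.congr' ?_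
    filter_upwards [hlog0] with n hn
    have h2 : ((q n : ℝ))⁻¹ = x n ^ s * (4 * c) := by
      simp only [q]
      rw [Real.rpow_neg (hx0 n).le]
      have := (Real.rpow_pos_of_pos (hx0 n) s).ne'
      field_simp
    rw [h2, Real.log_mul (Real.rpow_pos_of_pos (hx0 n) s).ne' (by positivity),
      Real.log_rpow (hx0 n), add_div, mul_div_assoc, div_self hn, mul_one]
  · refine Filter.Tendsto.div_of_div (h := fun n => Real.log (x n)) ?_ hN_lim (by linarith) hlog0
    refine (hk_lim.add hL_lim).congr fun n => ?_
    have hLn : (L n : ℝ) ≠ 0 := by exact_mod_cast (hL0 n).ne'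
    have hkn : (k n : ℝ) ≠ 0 := by exact_mod_cast (hk0 n).ne'
    rw [Nat.cast_mul, Real.log_mul hkn hLn, add_div]
  · refine tendsto_const_nhds.congr fun n => ?_
    rw [hpq, mul_div_cancel_right₀ _ (hq0 n).ne']
  · intro hPC φ hφ
    have hdensity : ∀ W : ℕ, ∃ γ : unitInterval, (γ : ℝ) * (c ^ W + 1) ≤ 1 ∧ PCConjecture γ := by
      intro W
      have h1 : 1 ≤ c ^ W := one_le_pow₀ hc.le
      have h2 : (c ^ W + 1)⁻¹ ≤ 1 / 2 := by
        rw [one_div]; exact inv_anti₀ two_pos (by linarith)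
      have h3 : 0 < (c ^ W + 1)⁻¹ := by positivity
      refine ⟨⟨(c ^ W + 1)⁻¹, h3.le, by linarith⟩, ?_, hPC _ h3 h2⟩
      exact (inv_mul_cancel₀ (by positivity)).le
    have hlogb : Tendsto (fun n : ℕ => Real.logb ((n + 1 : ℕ) : ℝ) (k n)) atTop (𝓝 κ) := hk_lim
    have hcq2 : ∀ n, c * (q n : ℝ) ≤ 1 / 2 := fun n => by rw [hcq]; linarith [hxs n]
    have hNT : ∀ n, (n + 1) * L n ≤ (n + 1) ^ (⌈t⌉₊ + 1) := fun n => by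
      rw [pow_succ, mul_comm]
      refine Nat.mul_le_mul_right _ (Nat.ceil_le.mpr ?_)
      calc x n ^ t ≤ x n ^ ((⌈t⌉₊ : ℕ) : ℝ) :=
            Real.rpow_le_rpow_of_exponent_le (hx1 n) (Nat.le_ceil t)
        _ = _ := by rw [Real.rpow_natCast, Nat.cast_pow]
    rcases hs with hs | ⟨rfl, rfl⟩
    · set ε := s - 2 * t with hε
      have hε0 : 0 < ε := by linarith
      -- From `2 κ < 1 ≤ ε W` follows `2 κ - ε (W + 1) ≤ -ε`: the loss over all `k²` blocks is `O(x
      -- ^ (-ε))`, while `W`, and so `γ`, does not depend on `n`.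
      obtain ⟨W, hW⟩ := exists_nat_ge (1 / ε)
      rw [div_le_iff₀ hε0] at hW
      obtain ⟨γ, hγ, hγPC⟩ := hdensity W
      have hν : ∀ n, c * (q n : ℝ) * (L n : ℝ) ^ 2 ≤ x n ^ (-ε) := fun n => by
        rw [hcq]
        have h1 : (L n : ℝ) ^ 2 ≤ (2 * x n ^ t) ^ 2 := pow_le_pow_left₀ (by positivity) (hLb n).2 2
        have h2 : x n ^ (-ε) = x n ^ (-s) * (x n ^ t) ^ 2 := by
          rw [← Real.rpow_natCast, ← Real.rpow_mul (hx0 n).le, ← Real.rpow_add (hx0 n), hε]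
          congr 1; push_cast; ring
        rw [h2]
        nlinarith [mul_le_mul_of_nonneg_left h1 (hxs n).1.le]
      have hνpos : ∀ n, 0 < x n ^ (-ε) := fun n => Real.rpow_pos_of_pos (hx0 n) _
      have hν1 : ∀ n, x n ^ (-ε) ≤ 1 := fun n =>
        Real.rpow_le_one_of_one_le_of_nonpos (hx1 n) (by linarith)
      refine one_le_liminf_errorPDS hc hγ (T := ⌈t⌉₊ + 1) (fun _ => rfl) hNT hL0 hk0 hkn hq0 hpq
        hcq2 (η := fun n => Real.exp 1 * (x n ^ (-ε)) ^ (W + 1))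
        (Δ := fun n => Real.exp (4 * (x n ^ (-ε) * (1 + Real.log (x n)))) - 1)
        (fun n => ?_) (fun n e B => ?_) (fun n => ?_) ?_ ?_ hκ hlogb hγPC φ hφ
      · have := hνpos n
        positivity
      · refine blockDefect_le _ hc (hq0 n) (by linarith [hcq2 n]) B (hνpos n) (hν1 n) ?_
        refine le_trans ?_ (hν n)
        have h1 : ((Finset.univ.filter fun y => Sym2.map (vertexMap e) y = B).card : ℝ) ≤
            (L n : ℝ) ^ 2 := by exact_mod_cast card_filter_map_vertexMap_le e B
        exact mul_le_mul_of_nonneg_left h1 (mul_nonneg hc0.le (hq0 n).le)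
      · rw [add_sub_cancel, ← Real.exp_nat_mul]
        apply Real.exp_le_exp.mpr
        have hL1 : (1 : ℝ) ≤ L n := by exact_mod_cast hL0 n
        have hk1 : (1 : ℝ) ≤ k n := by exact_mod_cast hk0 n
        have hkx : (k n : ℝ) ≤ x n := by simp only [hx]; exact_mod_cast hkn n
        have hy0 : 0 ≤ 2 * (c * (q n : ℝ)) * L n :=
          mul_nonneg (mul_nonneg two_pos.le (mul_nonneg hc0.le (hq0 n).le)) (by linarith)
        have hy1 : 2 * (c * (q n : ℝ)) * L n ≤ 1 := by
          rw [hcq]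
          have h1 : x n ^ (-s) * x n ^ t ≤ 1 := by
            rw [← Real.rpow_add (hx0 n)]
            exact Real.rpow_le_one_of_one_le_of_nonpos (hx1 n) (by linarith)
          nlinarith [mul_le_mul_of_nonneg_left (hLb n).2 (hxs n).1.le]
        -- Linearizing the exponential turns the chi-square exponent into `4 c q L² (1 + log x)`,
        -- which `hν` controls.
        have hexp : Real.exp (2 * (c * (q n : ℝ)) * L n) - 1 ≤ 2 * (2 * (c * (q n : ℝ)) * L n) := by
          have h := Real.abs_exp_sub_one_le (x := 2 * (c * (q n : ℝ)) * L n)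
            (by rw [abs_of_nonneg hy0]; exact hy1)
          rw [abs_of_nonneg hy0] at h
          exact (le_abs_self _).trans h
        have hlk : 1 + Real.log (k n) ≤ 1 + Real.log (x n) := by
          have := Real.log_le_log (by linarith) hkx
          linarith
        have hlk0 : 0 ≤ 1 + Real.log (k n) := by
          have := Real.log_nonneg hk1
          linarith
        have hLs : ((L n - 1 : ℕ) : ℝ) ≤ L n := by exact_mod_cast Nat.sub_le _ _
        have hlx0 : 0 ≤ 1 + Real.log (x n) := hlk0.trans hlk
        have hexp0 : 0 ≤ Real.exp (2 * (c * (q n : ℝ)) * L n) - 1 := by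
          linarith [Real.one_le_exp hy0]
        calc ((L n - 1 : ℕ) : ℝ) * ((Real.exp (2 * (c * (q n : ℝ)) * L n) - 1) *
              (1 + Real.log (k n))) ≤
              (L n : ℝ) * ((2 * (2 * (c * (q n : ℝ)) * L n)) * (1 + Real.log (x n))) := by
              gcongr
          _ = 4 * ((c * (q n : ℝ) * (L n : ℝ) ^ 2) * (1 + Real.log (x n))) := by ring
          _ ≤ 4 * (x n ^ (-ε) * (1 + Real.log (x n))) := by
              gcongr
              exact hν n
      · have hbound : Tendsto (fun n => 4 * Real.exp 1 * x n ^ (-ε)) atTop (𝓝 0) := by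
          have := ((tendsto_rpow_neg_atTop hε0).comp tendsto_cast_add_one_atTop).const_mul
            (4 * Real.exp 1)
          rwa [mul_zero] at this
        refine squeeze_zero (fun n => ?_) (fun n => ?_) hbound
        · have := hνpos n
          positivity
        · have h1 : (k n : ℝ) ^ 2 ≤ (2 * x n ^ κ) ^ 2 :=
            pow_le_pow_left₀ (by positivity) (hkb n).2 2
          have h2 : (x n ^ κ) ^ 2 * (x n ^ (-ε)) ^ (W + 1) ≤ x n ^ (-ε) := by
            rw [← Real.rpow_natCast, ← Real.rpow_natCast, ← Real.rpow_mul (hx0 n).le,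
              ← Real.rpow_mul (hx0 n).le, ← Real.rpow_add (hx0 n)]
            refine Real.rpow_le_rpow_of_exponent_le (hx1 n) ?_
            push_cast
            nlinarith
          have h3 : 0 < Real.exp 1 * (x n ^ (-ε)) ^ (W + 1) := by
            have := hνpos n
            positivity
          calc (k n : ℝ) ^ 2 * (Real.exp 1 * (x n ^ (-ε)) ^ (W + 1)) ≤
                (2 * x n ^ κ) ^ 2 * (Real.exp 1 * (x n ^ (-ε)) ^ (W + 1)) := by gcongr
            _ = 4 * Real.exp 1 * ((x n ^ κ) ^ 2 * (x n ^ (-ε)) ^ (W + 1)) := by ring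
            _ ≤ 4 * Real.exp 1 * x n ^ (-ε) := by gcongr
      · have h1 := (tendsto_rpow_neg_mul_one_add_log hε0).const_mul 4
        have h2 := ((Real.continuous_exp.tendsto _).comp h1).sub_const 1
        rwa [mul_zero, Real.exp_zero, sub_self] at h2
    -- Here `L = 1`: blocks have at most one pair, so truncating at `W = 1` loses nothing, and the
    -- exponent `L - 1 = 0` reflects that no pairs are merged.
    · obtain ⟨γ, hγ, hγPC⟩ := hdensity 1
      have hL1 : ∀ n, L n = 1 := fun n => by simp [hL]
      refine one_le_liminf_errorPDS hc hγ (T := ⌈(0 : ℝ)⌉₊ + 1) (fun _ => rfl) hNT hL0 hk0 hkn hq0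
        hpq hcq2 (η := fun _ => 0) (Δ := fun _ => 0) (fun n => le_rfl) (fun n e B => ?_)
        (fun n => ?_) ?_ tendsto_const_nhds hκ hlogb hγPC φ hφ
      · refine (blockDefect_eq_zero _ hc (hq0 n) (by linarith [hcq2 n]) B ?_).le
        exact (card_filter_map_vertexMap_le e B).trans (by rw [hL1 n]; norm_num)
      · simp [hL1 n]
      · simp

/-- The computational lower bound. -/
theorem exists_regime_hard_of_lt {c : ℝ} (hc : 1 < c) {α β : ℝ} (hα : α ∈ Set.Ico (0 : ℝ) 2)
    (hβ : β ∈ Set.Ioo (0 : ℝ) 1) (h : β < 1 / 2 + α / 4) :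
    ∃ (N K : ℕ → ℕ) (p q : ℕ → unitInterval), PDSRegime c α β N K p q ∧
      ((∀ γ : unitInterval, 0 < γ → (γ : ℝ) ≤ 1 / 2 → PCConjecture γ) →
        ∀ φ : ∀ n, RandomizedTest (N n), IsPolyTime φ →
          1 ≤ liminf (fun n => errorPDS (N n) (K n) (p n) (q n) (φ n)) atTop) := by
  obtain ⟨hα0, hα2⟩ := hα
  obtain ⟨hβ0, hβ1⟩ := hβ
  rcases hα0.eq_or_lt with rfl | hα0
  · have := exists_regime_hard hc (t := 0) (κ := β) (s := 0) le_rfl hβ0 (by linarith)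
      (Or.inr ⟨rfl, rfl⟩)
    simpa using this
  -- `τ = t / (1 + t)` is the share of the blow-up in the exponent of `N`. The bounds `2 β - 1 < τ`,
  -- `τ < α / 2` and `τ < β` translate to `κ < 1 / 2`, `2 t < s` and `0 < κ`; the first two are
  -- compatible exactly if `β < 1 / 2 + α / 4`.
  · obtain ⟨τ, hτ, hτ'⟩ : ∃ τ, max 0 (2 * β - 1) < τ ∧ τ < min (α / 2) β := by
      apply exists_between
      rw [max_lt_iff, lt_min_iff, lt_min_iff]
      exact ⟨⟨by linarith, hβ0⟩, by linarith, by linarith⟩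
    rw [max_lt_iff] at hτ
    rw [lt_min_iff] at hτ'
    have h1τ : 0 < 1 - τ := by linarith
    have ht : 1 + τ / (1 - τ) = 1 / (1 - τ) := by field_simp; ring
    have := exists_regime_hard hc (t := τ / (1 - τ)) (κ := (β - τ) / (1 - τ)) (s := α / (1 - τ))
      (div_nonneg hτ.1.le h1τ.le) (div_pos (by linarith) h1τ)
      (by rw [div_lt_iff₀ h1τ]; linarith)
      (Or.inl (by rw [← mul_div_assoc]; exact div_lt_div_of_pos_right (by linarith) h1τ))
    have e1 : α / (1 - τ) / (1 + τ / (1 - τ)) = α := by rw [ht]; field_simp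
    have e2 : ((β - τ) / (1 - τ) + τ / (1 - τ)) / (1 + τ / (1 - τ)) = β := by
      rw [ht, ← add_div]; field_simp; ring
    rwa [e1, e2] at this

end Asymptotics

/-! ### The edge counting test -/

section UpperBound

theorem card_insidePairs {n : ℕ} (S : Finset (Fin n)) :
    (insidePairs S).card = S.card.choose 2 := by
  classical
  rw [← Sym2.card_image_offDiag]
  congr 1
  ext x
  induction x using Sym2.ind with
  | _ i j =>
    rw [mk_mem_insidePairs]
    simp only [Finset.mem_image, Finset.mem_offDiag, Prod.exists]
    constructor
    · rintro ⟨h, hi, hj⟩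
      exact ⟨i, j, ⟨hi, hj, h⟩, rfl⟩
    · rintro ⟨a, b, ⟨ha, hb, hab⟩, h⟩
      rcases Sym2.eq_iff.mp h with ⟨rfl, rfl⟩ | ⟨rfl, rfl⟩
      · exact ⟨hab, ha, hb⟩
      · exact ⟨hab.symm, hb, ha⟩

theorem card_offDiagPairs (n : ℕ) : (offDiagPairs n).card = n.choose 2 := by
  have h : offDiagPairs n = insidePairs Finset.univ := by
    ext x; simp [offDiagPairs, insidePairs]
  rw [h, card_insidePairs, Finset.card_univ, Fintype.card_fin]

/-- A list of representatives of the non-diagonal pairs. -/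
noncomputable def pairList (n : ℕ) : List (Fin n × Fin n) :=
  (offDiagPairs n).toList.map Quot.out

theorem edgeCount_pairList {n : ℕ} (ω : Sym2 (Fin n) → Bool) :
    (edgeCount (configGraph ω) (pairList n) : ℝ) = ∑ x ∈ offDiagPairs n, bit (ω x) := by
  classical
  have hadj : ∀ x ∈ offDiagPairs n,
      (configGraph ω).Adj (Quot.out x).1 (Quot.out x).2 ↔ ω x = true := by
    intro x hx
    have hx' : s((Quot.out x).1, (Quot.out x).2) = x := Quot.out_eq x
    have hd := (Finset.mem_filter.mp hx).2
    rw [← hx', Sym2.mk_isDiag_iff] at hd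
    simp only [configGraph, hx']
    exact and_iff_right hd
  have hsum : ∑ x ∈ offDiagPairs n, bit (ω x) =
      (((offDiagPairs n).filter fun x => ω x = true).card : ℝ) := by
    simp only [bit]
    rw [Finset.sum_boole]
  rw [hsum, edgeCount, pairList, List.countP_map, List.countP_eq_length_filter]
  congr 1
  have h2 : ((offDiagPairs n).filter fun x => ω x = true).card =
      ((offDiagPairs n).toList.filter fun x => decide (ω x = true)).length := by
    rw [← Finset.length_toList]
    refine List.Perm.length_eq ?_
    refine (List.perm_ext_iff_of_nodup (Finset.nodup_toList _)
      ((Finset.nodup_toList _).filter _)).mpr fun x => ?_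
    simp
  rw [h2]
  congr 1
  refine List.filter_congr fun x hx => ?_
  exact decide_eq_decide.mpr (hadj x (Finset.mem_toList.mp hx))

/-- The threshold of the edge counting test. -/
noncomputable def edgeThreshold (n k : ℕ) (p q : ℝ) : ℝ :=
  (n.choose 2 : ℝ) * q + (k.choose 2 : ℝ) * (p - q) / 2

/-- The test that compares the number of edges with its threshold. -/
noncomputable def edgeTest (n k : ℕ) (p q : ℝ) : RandomizedTest n :=
  countTest ⌈edgeThreshold n k p q⌉₊ (pairList n)

theorem cost_edgeTest_le {n k : ℕ} (hk : k ≤ n) (p q : unitInterval) :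
    (edgeTest n k p q).cost ≤ n ^ 2 * (3 * n ^ 2 + 1) + 3 := by
  have hchoose : n.choose 2 ≤ n ^ 2 := Nat.choose_le_pow n 2
  have hlen : (pairList n).length ≤ n ^ 2 := by
    rw [pairList, List.length_map, Finset.length_toList, card_offDiagPairs]
    exact hchoose
  -- The threshold is the length of the unary counter, so it enters the cost.
  have hT : ⌈edgeThreshold n k (p : ℝ) q⌉₊ ≤ n ^ 2 := by
    refine le_trans (Nat.ceil_le.mpr ?_) hchoose
    have h1 : (k.choose 2 : ℝ) ≤ (n.choose 2 : ℝ) := by exact_mod_cast Nat.choose_le_choose 2 hk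
    have h2 : (0 : ℝ) ≤ (k.choose 2 : ℝ) := by positivity
    have h3 : (k.choose 2 : ℝ) * ((p : ℝ) - q) ≤ (n.choose 2 : ℝ) * (1 - q) := by
      calc (k.choose 2 : ℝ) * ((p : ℝ) - q) ≤ (k.choose 2 : ℝ) * (1 - q) := by
            gcongr
            exact p.2.2
        _ ≤ _ := by
            gcongr
            linarith [q.2.2]
    have h4 : 0 ≤ (n.choose 2 : ℝ) * (1 - q) := mul_nonneg (by positivity) (by linarith [q.2.2])
    unfold edgeThreshold
    linarith
  rw [edgeTest, cost_countTest]
  gcongr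

theorem sum_plantedProb {n : ℕ} (S : Finset (Fin n)) (p q : ℝ) :
    ∑ x ∈ offDiagPairs n, plantedProb S p q x =
      (n.choose 2 : ℝ) * q + (S.card.choose 2 : ℝ) * (p - q) := by
  classical
  have h1 : ∀ x, plantedProb S p q x = q + if ∀ i ∈ x, i ∈ S then p - q else 0 := by
    intro x
    unfold plantedProb
    split_ifs <;> ring
  simp only [h1]
  rw [Finset.sum_add_distrib, Finset.sum_const, card_offDiagPairs, ← Finset.sum_filter,
    Finset.sum_const, nsmul_eq_mul, nsmul_eq_mul]
  congr 3
  rw [← card_insidePairs]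
  congr 1
  ext x
  simp [offDiagPairs, insidePairs]

/-- Chebyshev: under either hypothesis an error needs a deviation of half the gap `(k.choose 2) * (p
- q)` between the means. The variances are at most `(n.choose 2) * q` and `(n.choose 2) * p`. -/
theorem errorPDS_edgeTest_le {n k : ℕ} (hk : k ≤ n) {p q : unitInterval} (hpq : (q : ℝ) < p)
    (hk2 : 2 ≤ k) :
    errorPDS n k p q (edgeTest n k p q) ≤
      4 * ((n.choose 2 : ℝ) * (p + q)) / ((k.choose 2 : ℝ) * (p - q)) ^ 2 := by
  classical
  set M : ℝ := (k.choose 2 : ℝ) with hM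
  have hM0 : 0 < M := by simp only [hM]; exact_mod_cast Nat.choose_pos hk2
  have hMn : M ≤ (n.choose 2 : ℝ) := by
    simp only [hM]; exact_mod_cast Nat.choose_le_choose 2 hk
  set D : ℝ := M * (p - q) / 2 with hD
  have hD0 : 0 < D := by
    have : 0 < (p : ℝ) - q := by linarith
    positivity
  set X : (Sym2 (Fin n) → Bool) → ℝ := fun ω => ∑ x ∈ offDiagPairs n, bit (ω x) with hX
  have hacc : ∀ ω, (edgeTest n k p q).acceptProb (configGraph ω) =
      if (n.choose 2 : ℝ) * q + D ≤ X ω then 1 else 0 := by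
    intro ω
    rw [edgeTest, acceptProb_countTest]
    have : ⌈edgeThreshold n k (p : ℝ) q⌉₊ ≤ edgeCount (configGraph ω) (pairList n) ↔
        (n.choose 2 : ℝ) * q + D ≤ X ω := by
      rw [Nat.ceil_le, edgeCount_pairList]
      rfl
    simp only [this]
  have hsq0 : ∑ x ∈ offDiagPairs n, (q : ℝ) = (n.choose 2 : ℝ) * q := by
    rw [Finset.sum_const, card_offDiagPairs, nsmul_eq_mul]
  have h0 : ∫ G, (edgeTest n k p q).acceptProb G ∂(SimpleGraph.binomialRandom (Fin n) q) ≤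
      (n.choose 2 : ℝ) * q / D ^ 2 := by
    rw [integral_binomialRandom]
    have hvar := bernExp_variance_le (fun _ : Sym2 (Fin n) => (q : ℝ)) (offDiagPairs n)
    rw [hsq0] at hvar
    rw [div_eq_inv_mul]
    refine le_trans ?_ (mul_le_mul_of_nonneg_left hvar (by positivity))
    rw [← bernExp_const_mul]
    refine bernExp_mono (fun _ => q.2.1) (fun _ => q.2.2) fun ω => ?_
    rw [hacc]
    split_ifs with h
    · rw [inv_mul_eq_div, one_le_div (by positivity)]
      exact pow_le_pow_left₀ hD0.le (by simp only [hX] at h; linarith) 2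
    · positivity
  have h1 : ∫ G, (1 - (edgeTest n k p q).acceptProb G) ∂(plantedDense n k p q) ≤
      (n.choose 2 : ℝ) * p / D ^ 2 := by
    refine integral_plantedDense_le hk p q _ fun S hS => ?_
    have hvar := bernExp_variance_le (plantedProb S (p : ℝ) q) (offDiagPairs n)
    have hmean := sum_plantedProb S (p : ℝ) q
    rw [hS, ← hM] at hmean
    rw [hmean] at hvar
    have hle : (n.choose 2 : ℝ) * q + M * (p - q) ≤ (n.choose 2 : ℝ) * p := by
      nlinarith [mul_le_mul_of_nonneg_right hMn (sub_nonneg.mpr hpq.le)]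
    rw [div_eq_inv_mul]
    refine le_trans ?_ (mul_le_mul_of_nonneg_left (hvar.trans hle) (by positivity))
    rw [← bernExp_const_mul]
    refine bernExp_mono (plantedProb_nonneg S p q) (plantedProb_le_one S p q) fun ω => ?_
    rw [hacc]
    split_ifs with h
    · rw [sub_self]; positivity
    · rw [sub_zero, inv_mul_eq_div, one_le_div (by positivity)]
      have h2 : D ≤ |∑ x ∈ offDiagPairs n, bit (ω x) - ((n.choose 2 : ℝ) * q + M * (p - q))| := by
        rw [abs_sub_comm]
        refine le_trans ?_ (le_abs_self _)
        simp only [hX, hD] at h ⊢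
        linarith
      rw [← sq_abs (∑ x ∈ offDiagPairs n, bit (ω x) - _)]
      exact pow_le_pow_left₀ hD0.le h2 2
  refine (add_le_add h0 h1).trans (le_of_eq ?_)
  have hpq' : (p : ℝ) - q ≠ 0 := by linarith
  rw [hD]
  field_simp
  ring

/-- The computational upper bound. -/
theorem exists_edgeTest_tendsto {c : ℝ} (hc : 1 < c) {α β : ℝ} (hβ0 : 0 < β)
    (h : 1 / 2 + α / 4 < β) {N K : ℕ → ℕ} {p q : ℕ → unitInterval}
    (hreg : PDSRegime c α β N K p q) :
    ∃ φ : ∀ n, RandomizedTest (N n), IsPolyTime φ ∧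
      Tendsto (fun n => errorPDS (N n) (K n) (p n) (q n) (φ n)) atTop (𝓝 0) := by
  refine ⟨fun n => edgeTest (N n) (K n) (p n) (q n),
    ⟨Polynomial.X ^ 2 * (3 * Polynomial.X ^ 2 + 1) + 3, fun n => ?_⟩, ?_⟩
  · simpa using cost_edgeTest_le (hreg.K_le n) (p n) (q n)
  · have hlogN : Tendsto (fun n => Real.log (N n)) atTop atTop :=
      Real.tendsto_log_atTop.comp (tendsto_natCast_atTop_atTop.comp hreg.tendsto_N)
    have hlogpos := hlogN.eventually_gt_atTop 0
    have hrate : Tendsto (fun n => (2 * Real.log (N n) - 4 * Real.log (K n) +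
        Real.log ((q n : ℝ)⁻¹)) / Real.log (N n)) atTop (𝓝 (2 - 4 * β + α)) := by
      have h1 := ((tendsto_const_nhds (x := (2 : ℝ))).sub (hreg.rate_K.const_mul 4)).add hreg.rate_q
      refine h1.congr' ?_
      filter_upwards [hlogpos] with n hn
      field_simp
    have hbot : Tendsto (fun n => 2 * Real.log (N n) - 4 * Real.log (K n) +
        Real.log ((q n : ℝ)⁻¹)) atTop atBot := by
      refine (hlogN.atTop_mul_neg (by linarith) hrate).congr' ?_
      filter_upwards [hlogpos] with n hn
      field_simp
    have hexp := Real.tendsto_exp_atBot.comp hbot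
    have hq : ∀ n, 0 < (q n : ℝ) := fun n => hreg.q_pos n
    have hK : ∀ n, (0 : ℝ) < K n := fun n => by exact_mod_cast hreg.K_pos n
    have hN : ∀ n, (0 : ℝ) < N n := fun n => by
      exact_mod_cast (hreg.K_pos n).trans_le (hreg.K_le n)
    have hform : ∀ n, Real.exp (2 * Real.log (N n) - 4 * Real.log (K n) +
        Real.log ((q n : ℝ)⁻¹)) = (N n : ℝ) ^ 2 / ((K n : ℝ) ^ 4 * q n) := by
      intro n
      rw [Real.exp_add, Real.exp_sub, Real.exp_log (inv_pos.mpr (hq n)),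
        show (2 : ℝ) * Real.log (N n) = ((2 : ℕ) : ℝ) * Real.log (N n) by norm_num,
        show (4 : ℝ) * Real.log (K n) = ((4 : ℕ) : ℝ) * Real.log (K n) by norm_num,
        Real.exp_nat_mul, Real.exp_nat_mul, Real.exp_log (hN n), Real.exp_log (hK n)]
      have := (hq n).ne'
      have := (hK n).ne'
      field_simp
    set δ := (c - 1) / 2 with hδ
    have hδ0 : 0 < δ := by simp only [hδ]; linarith
    -- Eventually `p - q ≥ δ q` and `p + q ≤ (c + 2) q`; with `K.choose 2 ≥ K ^ 2 / 4` the Chebyshev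
    -- bound gives the factor `4 * 16 = 64`.
    set C := 64 * (c + 2) / δ ^ 2 with hC
    have hlim : Tendsto (fun n => C * Real.exp (2 * Real.log (N n) - 4 * Real.log (K n) +
        Real.log ((q n : ℝ)⁻¹))) atTop (𝓝 0) := by
      have := hexp.const_mul C
      rwa [mul_zero] at this
    refine squeeze_zero' (Eventually.of_forall fun n => RandomizedTest.error_nonneg _ _ _) ?_ hlim
    filter_upwards [hlogpos, hreg.rate_K.eventually_const_lt hβ0,
      hreg.ratio.eventually_const_lt (show 1 + δ < c by simp only [hδ]; linarith),
      hreg.ratio.eventually_lt_const (show c < c + 1 by linarith)] with n hn hKn hlow hup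
    -- As `β > 0`, the planted set eventually has at least two vertices, so the gap between the
    -- means is positive.
    have hK2 : 2 ≤ K n := by
      have h1 : 0 < Real.log (K n) := by
        by_contra! hneg
        exact absurd hKn (not_lt.mpr (div_nonpos_of_nonpos_of_nonneg hneg hn.le))
      have h2 : 1 < (K n : ℝ) := (Real.log_pos_iff (hK n).le).mp h1
      exact_mod_cast h2
    rw [lt_div_iff₀ (hq n)] at hlow
    rw [div_lt_iff₀ (hq n)] at hup
    have hqn := hq n
    have hpq : (q n : ℝ) < p n := by nlinarith
    refine (errorPDS_edgeTest_le (hreg.K_le n) hpq hK2).trans ?_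
    rw [hform]
    have hN2 : ((N n).choose 2 : ℝ) ≤ (N n : ℝ) ^ 2 := by exact_mod_cast Nat.choose_le_pow (N n) 2
    have hKc : (K n : ℝ) ^ 2 / 4 ≤ ((K n).choose 2 : ℝ) := by
      rw [Nat.cast_choose_two]
      have : (2 : ℝ) ≤ K n := by exact_mod_cast hK2
      nlinarith
    have hden : ((K n : ℝ) ^ 2 / 4 * (δ * q n)) ^ 2 ≤
        (((K n).choose 2 : ℝ) * ((p n : ℝ) - q n)) ^ 2 := by
      gcongr
      linarith
    have hnum : 4 * (((N n).choose 2 : ℝ) * ((p n : ℝ) + q n)) ≤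
        4 * ((N n : ℝ) ^ 2 * ((c + 2) * q n)) := by
      have : (0 : ℝ) ≤ (p n : ℝ) + q n := by linarith
      gcongr
      linarith
    have hden0 : 0 < ((K n : ℝ) ^ 2 / 4 * (δ * q n)) ^ 2 := by
      have := hK n
      positivity
    calc 4 * (((N n).choose 2 : ℝ) * ((p n : ℝ) + q n)) /
          (((K n).choose 2 : ℝ) * ((p n : ℝ) - q n)) ^ 2 ≤
          4 * ((N n : ℝ) ^ 2 * ((c + 2) * q n)) / ((K n : ℝ) ^ 2 / 4 * (δ * q n)) ^ 2 := by
          gcongr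
      _ = C * ((N n : ℝ) ^ 2 / ((K n : ℝ) ^ 4 * q n)) := by
          have := hK n
          rw [hC]
          field_simp
          ring

end UpperBound

theorem mainTheorem3 (c : ℝ) (hc : 1 < c) (α : ℝ) (hα : α ∈ Set.Ico (0 : ℝ) 2) :
    (∀ β ∈ Set.Ioo (0 : ℝ) 1, β < 1 / 2 + α / 4 →
      ∃ (N K : ℕ → ℕ) (p q : ℕ → unitInterval),
        PDSRegime c α β N K p q ∧
        ((∀ γ : unitInterval, 0 < γ → (γ : ℝ) ≤ 1 / 2 → PCConjecture γ) →
          ∀ φ : ∀ n, RandomizedTest (N n), IsPolyTime φ →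
            1 ≤ liminf (fun n => errorPDS (N n) (K n) (p n) (q n) (φ n)) atTop)) ∧
    (∀ β ∈ Set.Ioo (0 : ℝ) 1, 1 / 2 + α / 4 < β →
      ∀ (N K : ℕ → ℕ) (p q : ℕ → unitInterval), PDSRegime c α β N K p q →
        ∃ φ : ∀ n, RandomizedTest (N n), IsPolyTime φ ∧
          Tendsto (fun n => errorPDS (N n) (K n) (p n) (q n) (φ n)) atTop (𝓝 0)) :=
  ⟨fun _ hβ h => exists_regime_hard_of_lt hc hα hβ h,
    fun _ hβ h _ _ _ _ hreg => exists_edgeTest_tendsto hc hβ.1 h hreg⟩
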